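/- Let $k$ be a field. A differential calculus $(\Omega^*A,\wedge,d)$ on a (unital, possibly noncommutative) $k$-algebra $A$ is a graded $k$-algebra $\bigoplus_{n\ge0}\Omega^nA$ with $\Omega^0A=A$ and a linear map $d:\Omega^nA\to\Omega^{n+1}A$ satisfying $d^2=0$, $d(\xi\wedge\eta)=d\xi\wedge\eta+(-1)^{|\xi|}\xi\wedge d\eta$, $\Omega^1A\wedge\Omega^nA=\Omega^{n+1}A$ and $A\cdot dA=\Omega^1A$. A left covariant derivative on a left $A$-module $E$ is a linear map $\nabla:E\to\Omega^1A\otimes_AE$ with $\nabla(ae)=da\otimes e+a\nabla e$; put $\nabla^{[n]}(\omega\otimes e)=d\omega\otimes e+(-1)^n\omega\wedge\nabla e$. It has zero curvature if $\nabla^{[1]}\nabla=0$, and then $H^*(A;E,\nabla)$ is the cohomology of the complex $(\Omega^nA\otimes_AE,\nabla^{[n]})_{n\ge 0}$. Let $A,B$ be $k$-algebras with differential calculi and let $\iota:B\to A$ be an algebra map extending to a map of differential graded algebras $\iota_*:\Omega^*B\to\Omega^*A$. Put $D_{p,q}=\iota_*\Omega^pB\wedge\Omega^qA$ (linear span of products;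 $D_{p,-1}=0$) and $N_{p,q}=D_{p,q}/D_{p+1,q-1}$. Assume: 1. $\iota$ is a differential fibration: for all $p,q\ge0$ the map $\xi\otimes[x]\mapsto[\iota_*\xi\wedge x]$ is an isomorphism $\Omega^pB\otimes_BN_{0,q}\to N_{p,q}$; 2. $E$ is a flat left $A$-module with a zero-curvature left covariant derivative $\nabla_E$; 3. each $\Omega^pB$ is flat as a right $B$-module. Let $C^n=\Omega^nA\otimes_AE$ with differential $\nabla_E^{[n]}$, filtered by the subspaces $F^mC^n$ spanned by all $(\iota_*\xi\wedge\eta)\otimes e$ with $\xi\in\Omega^mB$, $\eta\in\Omega^{n-m}A$, $e\in E$ (zero for $m>n$). Let $M_{0,q}=C^q/F^1C^q=\Omega^qA\otimes_AE/(\iota_*\Omega^1B\wedge\Omega^{q-1}A\otimes_AE)$, with the left $B$-action $b[\eta\otimes e]=[\iota(b)\eta\otimes e]$ and the $B$-linear differential $[y]\mapsto[\nabla_E^{[q]}y]$, and let $\hat H_q$ be the cohomology of this complex at $M_{0,q}$. Write $\langle y\rangle\in\hat H_q$ for the class of $y\in C^q$ with $\nabla_E^{[q]}y\in F^1C^{q+1}$.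 Then for every $q$ there is a zero-curvature left covariant derivative $\nabla_q:\hat H_q\to\Omega^1B\otimes_B\hat H_q$ induced by $\nabla_E$, in the sense that for every class $\langle x\rangle\in\hat H_q$ one has $\nabla_q\langle x\rangle=\sum_i\eta_i\otimes\langle y_i\rangle$ for some $\eta_i\in\Omega^1B$ and $y_i\in C^q$ representing classes in $\hat H_q$ with $\nabla_E^{[q]}x=\sum_i\iota_*\eta_i\wedge y_i$. Moreover there is a first-quadrant cohomological spectral sequence $(E_r^{p,q},d_r)_{r\ge1}$, $d_r$ of bidegree $(r,1-r)$, namely that of the filtration $F^*C$, i.e. $E_r^{p,q}=Z_r^{p,q}/(Z_{r-1}^{p+1,q-1}+B_{r-1}^{p,q})$ with $Z_r^{p,q}=F^pC^{p+q}\cap d^{-1}(F^{p+r}C^{p+q+1})$, $B_r^{p,q}=F^pC^{p+q}\cap d(F^{p-r}C^{p+q-1})$ (where $F^mC=C$ for $m<0$) and $d_r$ and the isomorphisms $H(E_r)\cong E_{r+1}$ induced by $d$ and by $z\mapsto z$, such that * its second page is $E_2^{p,q}\cong H^p(B;\hat H_q,\nabla_q)$, the isomorphism being induced by $\iota_*\xi\wedge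 y\mapsto\xi\otimes\langle y\rangle$; * it converges to $H^*(A;E,\nabla_E)$: with $F^pH^n$ the image of $H^n(F^pC)\to H^n(C)=H^n(A;E,\nabla_E)$, which is a decreasing filtration with $F^0H^n=H^n$ and $F^{n+1}H^n=0$, one has $E_\infty^{p,q}\cong F^pH^{p+q}/F^{p+1}H^{p+q}$ (by $[z]\mapsto[z]$), where $E_\infty^{p,q}=E_r^{p,q}$ for all $r>\max(p,q+1)$. -/

import Mathlib

open scoped TensorProduct
open MulOpposite

universe u

/-! ## Tensor products over a noncommutative algebra, and flatness -/

section BalancedTensor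

/-- The relations `m·r ⊗ n = m ⊗ r·n` imposed on `M ⊗[k] N`, where `M` is a right and `N` a left
module over the `k`-algebra `R`. -/
def balancedRel (k R M N : Type u) [Field k] [Ring R] [AddCommGroup M] [Module k M]
    [Module Rᵐᵒᵖ M] [AddCommGroup N] [Module k N] [Module R N] : Submodule k (M ⊗[k] N) :=
  Submodule.span k {t | ∃ (m : M) (r : R) (n : N), t = (op r • m) ⊗ₜ[k] n - m ⊗ₜ[k] (r • n)}

/-- `M ⊗_R N` for a right module `M` and a left module `N` over a (noncommutative) `k`-algebra. -/
def BalTensor (k R M N : Type u) [Field k] [Ring R] [AddCommGroup M] [Module k M]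
    [Module Rᵐᵒᵖ M] [AddCommGroup N] [Module k N] [Module R N] : Type u :=
  (M ⊗[k] N) ⧸ balancedRel k R M N

namespace BalTensor

variable {k R M N : Type u} [Field k] [Ring R] [AddCommGroup M] [Module k M]
    [Module Rᵐᵒᵖ M] [AddCommGroup N] [Module k N] [Module R N]

instance : AddCommGroup (BalTensor k R M N) :=
  inferInstanceAs (AddCommGroup ((M ⊗[k] N) ⧸ balancedRel k R M N))

instance : Module k (BalTensor k R M N) :=
  inferInstanceAs (Module k ((M ⊗[k] N) ⧸ balancedRel k R M N))

variable (k R M N) in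
/-- The bilinear map `(m, n) ↦ m ⊗ n`. -/
def mk : M →ₗ[k] N →ₗ[k] BalTensor k R M N :=
  (TensorProduct.mk k M N).compr₂ (balancedRel k R M N).mkQ

variable (k R) in
/-- The pure tensor `m ⊗ n`. -/
def tmul (m : M) (n : N) : BalTensor k R M N := mk k R M N m n

lemma smul_tmul' (m : M) (r : R) (n : N) :
    tmul k R (op r • m) n = tmul k R m (r • n) := by
  refine (Submodule.Quotient.eq (balancedRel k R M N)).2 ?_
  exact Submodule.subset_span ⟨m, r, n, rfl⟩

lemma induction_on {p : BalTensor k R M N → Prop} (x : BalTensor k R M N) (zero : p 0)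
    (tmul : ∀ m n, p (tmul k R m n)) (add : ∀ x y, p x → p y → p (x + y)) : p x := by
  obtain ⟨t, rfl⟩ := Submodule.Quotient.mk_surjective (balancedRel k R M N) x
  induction t using TensorProduct.induction_on with
  | zero => exact zero
  | tmul m n => exact tmul m n
  | add x y hx hy => exact add _ _ hx hy

/-- The universal property of `M ⊗_R N`. -/
def lift {P : Type u} [AddCommGroup P] [Module k P] (f : M →ₗ[k] N →ₗ[k] P)
    (hf : ∀ m (r : R) n, f (op r • m) n = f m (r • n)) : BalTensor k R M N →ₗ[k] P :=
  (balancedRel k R M N).liftQ (TensorProduct.lift f) (by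
    refine Submodule.span_le.2 ?_
    rintro _ ⟨m, r, n, rfl⟩
    simp [hf])

@[simp] lemma lift_tmul {P : Type u} [AddCommGroup P] [Module k P] (f : M →ₗ[k] N →ₗ[k] P)
    (hf : ∀ m (r : R) n, f (op r • m) n = f m (r • n)) (m : M) (n : N) :
    lift f hf (tmul k R m n) = f m n := rfl

lemma hom_ext {P : Type u} [AddCommGroup P] [Module k P] {f g : BalTensor k R M N →ₗ[k] P}
    (h : ∀ m n, f (tmul k R m n) = g (tmul k R m n)) : f = g := by
  ext x
  induction x using induction_on with
  | zero => simp
  | tmul m n => exact h m n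
  | add x y hx hy => simp [hx, hy]

lemma tmul_add (m : M) (n n' : N) :
    tmul k R m (n + n') = tmul k R m n + tmul k R m n' := by simp [tmul]

lemma add_tmul (m m' : M) (n : N) :
    tmul k R (m + m') n = tmul k R m n + tmul k R m' n := by simp [tmul]

lemma smul_tmul (c : k) (m : M) (n : N) :
    tmul k R (c • m) n = c • tmul k R m n := by simp [tmul]

lemma tmul_smul (c : k) (m : M) (n : N) :
    tmul k R m (c • n) = c • tmul k R m n := by simp [tmul]

/-- `id ⊗ g : M ⊗_R N → M ⊗_R N'` for a map `g` of left `R`-modules. -/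
def lTensor {N' : Type u} [AddCommGroup N'] [Module k N'] [Module R N']
    (M : Type u) [AddCommGroup M] [Module k M] [Module Rᵐᵒᵖ M]
    (g : N →ₗ[k] N') (hg : ∀ (r : R) n, g (r • n) = r • g n) :
    BalTensor k R M N →ₗ[k] BalTensor k R M N' :=
  lift ((mk k R M N').compl₂ g) (fun m r n => by
    change tmul k R (op r • m) (g n) = tmul k R m (g (r • n))
    rw [hg, smul_tmul'])

/-- `f ⊗ id : M ⊗_R N → M' ⊗_R N` for a map `f` of right `R`-modules. -/
def rTensor {M' : Type u} [AddCommGroup M'] [Module k M'] [Module Rᵐᵒᵖ M']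
    (N : Type u) [AddCommGroup N] [Module k N] [Module R N]
    (f : M →ₗ[k] M') (hf : ∀ (r : R) m, f (op r • m) = op r • f m) :
    BalTensor k R M N →ₗ[k] BalTensor k R M' N :=
  lift ((mk k R M' N).comp f) (fun m r n => by
    change tmul k R (f (op r • m)) n = tmul k R (f m) (r • n)
    rw [hf, smul_tmul'])

end BalTensor

/-- A right `R`-module `M` is flat if `M ⊗_R -` turns short exact sequences of left `R`-modules
into short exact sequences. (Modules over the `k`-algebra `R` carry the `k`-structure coming
from `R`, and `R`-linear maps are `k`-linear.) -/
def RightFlat (k R M : Type u) [Field k] [Ring R] [Algebra k R] [AddCommGroup M] [Module k M]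
    [Module Rᵐᵒᵖ M] : Prop :=
  ∀ (X Y Z : Type u) [AddCommGroup X] [AddCommGroup Y] [AddCommGroup Z]
    [Module k X] [Module k Y] [Module k Z] [Module R X] [Module R Y] [Module R Z]
    [IsScalarTower k R X] [IsScalarTower k R Y] [IsScalarTower k R Z]
    (f : X →ₗ[k] Y) (g : Y →ₗ[k] Z)
    (hf : ∀ (r : R) x, f (r • x) = r • f x) (hg : ∀ (r : R) y, g (r • y) = r • g y),
    Function.Injective f → Function.Exact f g → Function.Surjective g →
      Function.Injective (BalTensor.lTensor M f hf) ∧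
      Function.Exact (BalTensor.lTensor M f hf) (BalTensor.lTensor M g hg) ∧
      Function.Surjective (BalTensor.lTensor M g hg)

/-- A left `R`-module `N` is flat if `- ⊗_R N` turns short exact sequences of right `R`-modules
into short exact sequences. -/
def LeftFlat (k R N : Type u) [Field k] [Ring R] [Algebra k R] [AddCommGroup N] [Module k N]
    [Module R N] : Prop :=
  ∀ (X Y Z : Type u) [AddCommGroup X] [AddCommGroup Y] [AddCommGroup Z]
    [Module k X] [Module k Y] [Module k Z]
    [Module Rᵐᵒᵖ X] [Module Rᵐᵒᵖ Y] [Module Rᵐᵒᵖ Z]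
    [IsScalarTower k Rᵐᵒᵖ X] [IsScalarTower k Rᵐᵒᵖ Y] [IsScalarTower k Rᵐᵒᵖ Z]
    (f : X →ₗ[k] Y) (g : Y →ₗ[k] Z)
    (hf : ∀ (r : R) x, f (op r • x) = op r • f x) (hg : ∀ (r : R) y, g (op r • y) = op r • g y),
    Function.Injective f → Function.Exact f g → Function.Surjective g →
      Function.Injective (BalTensor.rTensor N f hf) ∧
      Function.Exact (BalTensor.rTensor N f hf) (BalTensor.rTensor N g hg) ∧
      Function.Surjective (BalTensor.rTensor N g hg)

end BalancedTensor

/-! ## Differential calculi -/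

/-- A differential calculus `(Ω^*A, d)` on a `k`-algebra `A`. The product of the graded algebra
`Form = ⊕ Ω^n A` is the wedge product, `deg n` is `Ω^n A`, and `of` identifies `A` with `Ω^0 A`. -/
structure DiffCalculus (k A : Type u) [Field k] [Ring A] [Algebra k A] where
  Form : Type u
  [ring : Ring Form]
  [algebra : Algebra k Form]
  deg : ℕ → Submodule k Form
  [graded : GradedAlgebra deg]
  of : A →ₐ[k] Form
  of_injective : Function.Injective of
  range_of : LinearMap.range of.toLinearMap = deg 0
  d : Form →ₗ[k] Form
  d_mem : ∀ n, ∀ x ∈ deg n, d x ∈ deg (n + 1)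
  d_d : ∀ x, d (d x) = 0
  leibniz : ∀ n, ∀ x ∈ deg n, ∀ y, d (x * y) = d x * y + (-1 : k) ^ n • (x * d y)
  one_mul_deg : ∀ n, deg 1 * deg n = deg (n + 1)
  span_d : Submodule.span k {x | ∃ a b : A, x = of a * d (of b)} = deg 1

namespace DiffCalculus

variable {k A : Type u} [Field k] [Ring A] [Algebra k A]

attribute [instance] DiffCalculus.ring DiffCalculus.algebra DiffCalculus.graded

/-- The space `Ω^n A` of `n`-forms. -/
def Ω (W : DiffCalculus k A) (n : ℕ) : Type u := W.deg n

variable (W : DiffCalculus k A)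

instance (n : ℕ) : AddCommGroup (W.Ω n) := inferInstanceAs (AddCommGroup (W.deg n))
instance (n : ℕ) : Module k (W.Ω n) := inferInstanceAs (Module k (W.deg n))

/-- The inclusion of `Ω^n A` into `⊕ Ω^n A`. -/
def val {n : ℕ} : W.Ω n →ₗ[k] W.Form := (W.deg n).subtype

lemma val_injective {n : ℕ} : Function.Injective (W.val (n := n)) := Subtype.val_injective

lemma val_mem {n : ℕ} (x : W.Ω n) : W.val x ∈ W.deg n := x.2

/-- Regard an element of `⊕ Ω^n A` that is homogeneous of degree `n` as an `n`-form. -/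
def homog {n : ℕ} (x : W.Form) (hx : x ∈ W.deg n) : W.Ω n := ⟨x, hx⟩

@[simp] lemma val_homog {n : ℕ} (x : W.Form) (hx : x ∈ W.deg n) : W.val (W.homog x hx) = x := rfl

lemma of_mem (a : A) : W.of a ∈ W.deg 0 := by
  rw [← W.range_of]; exact ⟨a, rfl⟩

lemma mul_mem' {p q n : ℕ} (h : p + q = n) {x y : W.Form} (hx : x ∈ W.deg p)
    (hy : y ∈ W.deg q) : x * y ∈ W.deg n := h ▸ SetLike.mul_mem_graded hx hy

/-- The wedge product `Ω^p A × Ω^q A → Ω^n A`, `p + q = n`. -/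
def mul {p q n : ℕ} (h : p + q = n) : W.Ω p →ₗ[k] W.Ω q →ₗ[k] W.Ω n :=
  LinearMap.mk₂ k (fun x y => W.homog (W.val x * W.val y) (W.mul_mem' h (W.val_mem x) (W.val_mem y)))
    (fun x x' y => W.val_injective (by simp [add_mul]))
    (fun c x y => W.val_injective (by simp))
    (fun x y y' => W.val_injective (by simp [mul_add]))
    (fun c x y => W.val_injective (by simp))

@[simp] lemma val_mul {p q n : ℕ} (h : p + q = n) (x : W.Ω p) (y : W.Ω q) :
    W.val (W.mul h x y) = W.val x * W.val y := rfl

/-- An element of `A` as a `0`-form. -/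
def ofΩ (a : A) : W.Ω 0 := W.homog (W.of a) (W.of_mem a)

@[simp] lemma val_ofΩ (a : A) : W.val (W.ofΩ a) = W.of a := rfl

/-- The differential `Ω^n A → Ω^m A`, `n + 1 = m`. -/
def dΩ {n m : ℕ} (h : n + 1 = m) : W.Ω n →ₗ[k] W.Ω m where
  toFun x := W.homog (W.d (W.val x)) (h ▸ W.d_mem n _ (W.val_mem x))
  map_add' x y := W.val_injective (by simp)
  map_smul' c x := W.val_injective (by simp)

@[simp] lemma val_dΩ {n m : ℕ} (h : n + 1 = m) (x : W.Ω n) :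
    W.val (W.dΩ h x) = W.d (W.val x) := rfl

/-- The left `A`-module structure of `Ω^n A`. -/
instance leftModule (n : ℕ) : Module A (W.Ω n) where
  smul a x := W.mul (zero_add n) (W.ofΩ a) x
  one_smul x := W.val_injective (by change W.of 1 * W.val x = _; simp)
  mul_smul a b x := W.val_injective (by
    change W.of (a * b) * W.val x = W.of a * (W.of b * W.val x); simp [mul_assoc])
  smul_zero a := W.val_injective (by change W.of a * W.val 0 = _; simp)
  smul_add a x y := W.val_injective (by
    change W.of a * W.val (x + y) = W.of a * W.val x + W.of a * W.val y; simp [mul_add])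
  add_smul a b x := W.val_injective (by
    change W.of (a + b) * W.val x = W.of a * W.val x + W.of b * W.val x; simp [add_mul])
  zero_smul x := W.val_injective (by change W.of 0 * W.val x = _; simp)

/-- The right `A`-module structure of `Ω^n A`. -/
instance rightModule (n : ℕ) : Module Aᵐᵒᵖ (W.Ω n) where
  smul a x := W.mul (add_zero n) x (W.ofΩ a.unop)
  one_smul x := W.val_injective (by change W.val x * W.of 1 = _; simp)
  mul_smul a b x := W.val_injective (by
    change W.val x * W.of (b.unop * a.unop) = (W.val x * W.of b.unop) * W.of a.unop
    simp [mul_assoc])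
  smul_zero a := W.val_injective (by change W.val 0 * W.of a.unop = _; simp)
  smul_add a x y := W.val_injective (by
    change W.val (x + y) * W.of a.unop = W.val x * W.of a.unop + W.val y * W.of a.unop
    simp [add_mul])
  add_smul a b x := W.val_injective (by
    change W.val x * W.of (a.unop + b.unop) = W.val x * W.of a.unop + W.val x * W.of b.unop
    simp [mul_add])
  zero_smul x := W.val_injective (by change W.val x * W.of 0 = _; simp)

@[simp] lemma val_smul {n : ℕ} (a : A) (x : W.Ω n) : W.val (a • x) = W.of a * W.val x := rfl

@[simp] lemma val_op_smul {n : ℕ} (a : A) (x : W.Ω n) :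
    W.val (op a • x) = W.val x * W.of a := rfl

/-! ### Covariant derivatives and their cohomology -/

variable (E : Type u) [AddCommGroup E] [Module k E] [Module A E]

/-- `Ω^n A ⊗_A E`. -/
abbrev Tw (n : ℕ) : Type u := BalTensor k A (W.Ω n) E

/-- The pure tensor `ω ⊗ e` in `Ω^n A ⊗_A E`. -/
abbrev tw {E : Type u} [AddCommGroup E] [Module k E] [Module A E] {n : ℕ} (ω : W.Ω n) (e : E) :
    W.Tw E n := BalTensor.tmul k A ω e

variable {E}

/-- `Ω^p A × (Ω^q A ⊗_A E) → Ω^n A ⊗_A E`, `(ω, η ⊗ e) ↦ (ω ∧ η) ⊗ e`, where `p + q = n`. -/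
def wedge {p q n : ℕ} (h : p + q = n) : W.Ω p →ₗ[k] W.Tw E q →ₗ[k] W.Tw E n where
  toFun x := BalTensor.rTensor E (W.mul h x)
    (fun r m => W.val_injective (by simp [mul_assoc]))
  map_add' x x' := BalTensor.hom_ext (fun m n => by simp [BalTensor.rTensor])
  map_smul' c x := BalTensor.hom_ext (fun m n => by simp [BalTensor.rTensor])

@[simp] lemma wedge_tw {p q n : ℕ} (h : p + q = n) (x : W.Ω p) (y : W.Ω q) (e : E) :
    W.wedge h x (W.tw y e) = W.tw (W.mul h x y) e := rfl

lemma wedge_wedge {p q r s n m : ℕ} (h : q + r = s) (h' : p + s = n) (h1 : p + q = m)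
    (h2 : m + r = n) (x : W.Ω p) (y : W.Ω q) (t : W.Tw E r) :
    W.wedge h' x (W.wedge h y t) = W.wedge h2 (W.mul h1 x y) t := by
  induction t using BalTensor.induction_on with
  | zero => simp
  | tmul z e =>
    change W.wedge h' x (W.wedge h y (W.tw z e)) = W.wedge h2 (W.mul h1 x y) (W.tw z e)
    simp only [wedge_tw]
    congr 1
    exact W.val_injective (by simp [mul_assoc])
  | add a b ha hb => simp [ha, hb]

variable (E) in
/-- A left covariant derivative `∇ : E → Ω^1 A ⊗_A E`. -/
structure Connection where
  toFun : E →ₗ[k] W.Tw E 1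
  leibniz' : ∀ (a : A) (e : E),
    toFun (a • e) = W.tw (W.dΩ rfl (W.ofΩ a)) e + W.wedge (zero_add 1) (W.ofΩ a) (toFun e)

namespace Connection

variable {W}
variable (D : W.Connection E)

/-- `∇^{[n]} : Ω^n A ⊗_A E → Ω^m A ⊗_A E`, `ω ⊗ e ↦ dω ⊗ e + (-1)^n ω ∧ ∇e`, where `n + 1 = m`. -/
def ext {n m : ℕ} (h : n + 1 = m) : W.Tw E n →ₗ[k] W.Tw E m :=
  BalTensor.lift
    ((BalTensor.mk k A (W.Ω m) E).comp (W.dΩ h) +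
      (-1 : k) ^ n • (W.wedge h).compl₂ D.toFun)
    (fun ω a e => by
      simp only [LinearMap.add_apply, LinearMap.smul_apply, LinearMap.comp_apply,
        LinearMap.compl₂_apply, D.leibniz', map_add, wedge_tw, smul_add]
      rw [W.wedge_wedge (zero_add 1) h (add_zero n) h]
      have h1 : W.mul (add_zero n) ω (W.ofΩ a) = op a • ω := rfl
      have h2 : W.dΩ h (op a • ω)
          = op a • W.dΩ h ω + (-1 : k) ^ n • W.mul h ω (W.dΩ rfl (W.ofΩ a)) :=
        W.val_injective (by simp [W.leibniz n _ (W.val_mem ω)])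
      rw [h1, h2, map_add, LinearMap.add_apply,
        (BalTensor.mk k A (W.Ω m) E).map_smul, LinearMap.smul_apply]
      have h3 := BalTensor.smul_tmul' (k := k) (W.dΩ h ω) a e
      simp only [BalTensor.tmul] at h3
      rw [h3, add_assoc]
      rfl)

@[simp] lemma ext_tw {n m : ℕ} (h : n + 1 = m) (ω : W.Ω n) (e : E) :
    D.ext h (W.tw ω e) = W.tw (W.dΩ h ω) e + (-1 : k) ^ n • W.wedge h ω (D.toFun e) := by
  simp only [ext, BalTensor.lift_tmul]
  rfl

lemma ext_wedge {p q n m q' p' : ℕ} (h : p + q = n) (hm : n + 1 = m) (hq : q + 1 = q')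
    (hp : p + 1 = p') (h1 : p' + q = m) (h2 : p + q' = m) (x : W.Ω p) (t : W.Tw E q) :
    D.ext hm (W.wedge h x t)
      = W.wedge h1 (W.dΩ hp x) t + (-1 : k) ^ p • W.wedge h2 x (D.ext hq t) := by
  induction t using BalTensor.induction_on with
  | zero => simp
  | tmul z e =>
    change D.ext hm (W.wedge h x (W.tw z e))
      = W.wedge h1 (W.dΩ hp x) (W.tw z e) + (-1 : k) ^ p • W.wedge h2 x (D.ext hq (W.tw z e))
    simp only [wedge_tw, ext_tw, map_add, map_smul, smul_add]
    rw [W.wedge_wedge hq h2 h hm, smul_smul, ← pow_add, h, ← add_assoc]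
    congr 1
    rw [← BalTensor.smul_tmul, ← BalTensor.add_tmul]
    congr 1
    exact W.val_injective (by simp [W.leibniz p _ (W.val_mem x)])
  | add a b ha hb => simp only [map_add, ha, hb, smul_add]; abel

/-- The curvature `∇^{[1]} ∘ ∇` vanishes. -/
def IsFlat : Prop := ∀ e : E, D.ext (show 1 + 1 = 2 from rfl) (D.toFun e) = 0

/-- The coboundaries in `Ω^n A ⊗_A E`. -/
def coboundaries : ∀ n : ℕ, Submodule k (W.Tw E n)
  | 0 => ⊥
  | _ + 1 => LinearMap.range (D.ext rfl)

/-- The cocycles in `Ω^n A ⊗_A E`. -/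
def cocycles (n : ℕ) : Submodule k (W.Tw E n) := LinearMap.ker (D.ext (rfl : n + 1 = n + 1))

/-- The sheaf cohomology `H^n(A; E, ∇)`. For `n = 0` this uses `A ⊗_A E = E`. -/
abbrev Coh (n : ℕ) : Type u := D.cocycles n ⧸ (D.coboundaries n).submoduleOf (D.cocycles n)

/-- The cohomology class of a cocycle. -/
def cohMk {n : ℕ} : D.cocycles n →ₗ[k] D.Coh n :=
  ((D.coboundaries n).submoduleOf (D.cocycles n)).mkQ

end Connection

end DiffCalculus

/-! ## Differentiable maps and differential fibrations -/

/-- The extension of a differentiable algebra map `ι : B → A` to a map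
`ι_* : Ω^*B → Ω^*A` of differential graded algebras. -/
structure DiffMap {k A B : Type u} [Field k] [Ring A] [Algebra k A] [Ring B] [Algebra k B]
    (WB : DiffCalculus k B) (WA : DiffCalculus k A) (ι : B →ₐ[k] A) where
  toHom : WB.Form →ₐ[k] WA.Form
  map_of : ∀ b, toHom (WB.of b) = WA.of (ι b)
  map_deg : ∀ n, ∀ x ∈ WB.deg n, toHom x ∈ WA.deg n
  map_d : ∀ x, toHom (WB.d x) = WA.d (toHom x)

namespace DiffMap

open DiffCalculus

variable {k A B : Type u} [Field k] [Ring A] [Algebra k A] [Ring B] [Algebra k B]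
    {WB : DiffCalculus k B} {WA : DiffCalculus k A} {ι : B →ₐ[k] A} (φ : DiffMap WB WA ι)

/-- `ι_* : Ω^n B → Ω^n A`. -/
def onΩ {n : ℕ} : WB.Ω n →ₗ[k] WA.Ω n where
  toFun x := WA.homog (φ.toHom (WB.val x)) (φ.map_deg n _ (WB.val_mem x))
  map_add' x y := WA.val_injective (by simp)
  map_smul' c x := WA.val_injective (by simp)

@[simp] lemma val_onΩ {n : ℕ} (x : WB.Ω n) : WA.val (φ.onΩ x) = φ.toHom (WB.val x) := rfl

/-- `D_{p,q} = ι_*Ω^p B ∧ Ω^q A`, the span of the products `ι_*ξ ∧ η`. -/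
def D (p q : ℕ) : Submodule k WA.Form := (WB.deg p).map φ.toHom.toLinearMap * WA.deg q

/-- `D_{p+1,q-1}`, which is `0` for `q = 0`. -/
def Dnext (p : ℕ) : ℕ → Submodule k WA.Form
  | 0 => ⊥
  | q + 1 => φ.D (p + 1) q

lemma mul_mem_D {r p q s : ℕ} (h : r + p = s) {ξ : WB.Form} (hξ : ξ ∈ WB.deg r) {x : WA.Form}
    (hx : x ∈ φ.D p q) : φ.toHom ξ * x ∈ φ.D s q := by
  induction hx using Submodule.mul_induction_on' with
  | mem_mul_mem m hm n hn =>
    obtain ⟨m, hm, rfl⟩ := hm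
    rw [← mul_assoc]
    refine Submodule.mul_mem_mul ⟨ξ * m, WB.mul_mem' h hξ hm, by simp⟩ hn
  | add x _ y _ hx hy => rw [mul_add]; exact add_mem hx hy

lemma mul_mem_Dnext {p q : ℕ} {ξ : WB.Form} (hξ : ξ ∈ WB.deg 0) {x : WA.Form}
    (hx : x ∈ φ.Dnext p q) : φ.toHom ξ * x ∈ φ.Dnext p q := by
  cases q with
  | zero =>
    have hx' : x = 0 := hx
    subst hx'
    simp
  | succ q => exact φ.mul_mem_D (zero_add _) hξ hx

/-- `D_{p,q}` as a type. -/
def DMod (p q : ℕ) : Type u := φ.D p q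

instance (p q : ℕ) : AddCommGroup (φ.DMod p q) := inferInstanceAs (AddCommGroup (φ.D p q))
instance (p q : ℕ) : Module k (φ.DMod p q) := inferInstanceAs (Module k (φ.D p q))

/-- The left `B`-module structure `b · x = ι(b) x` of `D_{p,q}`. -/
instance (p q : ℕ) : Module B (φ.DMod p q) where
  smul b x := ⟨φ.toHom (WB.of b) * x.1, φ.mul_mem_D (zero_add p) (WB.of_mem b) x.2⟩
  one_smul x := Subtype.ext (by change φ.toHom (WB.of 1) * x.1 = _; simp)
  mul_smul a b x := Subtype.ext (by
    change φ.toHom (WB.of (a * b)) * x.1 = φ.toHom (WB.of a) * (φ.toHom (WB.of b) * x.1)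
    simp [mul_assoc])
  smul_zero a := Subtype.ext (mul_zero _)
  smul_add a x y := Subtype.ext (mul_add _ _ _)
  add_smul a b x := Subtype.ext (by
    change φ.toHom (WB.of (a + b)) * x.1 = φ.toHom (WB.of a) * x.1 + φ.toHom (WB.of b) * x.1
    simp [add_mul])
  zero_smul x := Subtype.ext (by change φ.toHom (WB.of 0) * x.1 = 0; simp)

instance (p q : ℕ) : IsScalarTower k B (φ.DMod p q) where
  smul_assoc c b x := Subtype.ext (by
    change φ.toHom (WB.of (c • b)) * x.1 = c • (φ.toHom (WB.of b) * x.1)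
    simp)

/-- `D_{p+1,q-1}` as a left `B`-submodule of `D_{p,q}`. -/
def DnextSub (p q : ℕ) : Submodule B (φ.DMod p q) where
  carrier := {x | x.1 ∈ φ.Dnext p q}
  add_mem' hx hy := add_mem (S := Submodule k WA.Form) hx hy
  zero_mem' := zero_mem (φ.Dnext p q)
  smul_mem' b _ hx := φ.mul_mem_Dnext (WB.of_mem b) hx

/-- `N_{p,q} = D_{p,q} / D_{p+1,q-1}`, with `N_{p,0} = D_{p,0}`. -/
abbrev N (p q : ℕ) : Type u := φ.DMod p q ⧸ φ.DnextSub p q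

/-- The element `ι_*ξ ∧ x` of `D_{p,q}`, for `ξ ∈ Ω^p B` and `x ∈ D_{0,q} = Ω^q A`. -/
def actD {p q : ℕ} (ξ : WB.Ω p) (x : φ.DMod 0 q) : φ.DMod p q :=
  ⟨φ.toHom (WB.val ξ) * x.1, φ.mul_mem_D (add_zero p) (WB.val_mem ξ) x.2⟩

/-- `ι` is a differential fibration: `ξ ⊗ [x] ↦ [ι_*ξ ∧ x]` is an isomorphism
`Ω^p B ⊗_B N_{0,q} → N_{p,q}` for all `p, q`. -/
def IsFibration : Prop :=
  ∀ p q : ℕ, ∃ f : BalTensor k B (WB.Ω p) (φ.N 0 q) ≃ₗ[k] φ.N p q,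
    ∀ (ξ : WB.Ω p) (x : φ.DMod 0 q),
      f (BalTensor.tmul k B ξ (Submodule.Quotient.mk x)) = Submodule.Quotient.mk (φ.actD ξ x)

/-! ### The filtration, the complex `M_{0,q}` and its cohomology -/

variable {E : Type u} [AddCommGroup E] [Module k E] [Module A E]

variable (E) in
/-- `F^m(Ω^n A ⊗_A E) = ι_*Ω^m B ∧ Ω^{n-m} A ⊗_A E`, the span of the elements
`(ι_*ξ ∧ η) ⊗ e`; it is `0` for `m > n`. -/
def F (m n : ℕ) : Submodule k (WA.Tw E n) :=
  Submodule.span k {t | ∃ (q : ℕ) (h : m + q = n) (ξ : WB.Ω m) (η : WA.Ω q) (e : E),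
    t = WA.tw (WA.mul h (φ.onΩ ξ) η) e}

lemma wedge_mem_F {m q n : ℕ} (h : m + q = n) (ξ : WB.Ω m) (t : WA.Tw E q) :
    WA.wedge h (φ.onΩ ξ) t ∈ φ.F E m n := by
  induction t using BalTensor.induction_on with
  | zero => simp
  | tmul z e =>
    change WA.wedge h (φ.onΩ ξ) (WA.tw z e) ∈ _
    rw [wedge_tw]
    exact Submodule.subset_span ⟨q, h, ξ, z, e, rfl⟩
  | add a b ha hb => rw [map_add]; exact add_mem ha hb

lemma wedge_F_mem {p m n s r : ℕ} (h : p + m = s) (h' : p + n = r) (ξ : WB.Ω p) {t : WA.Tw E n}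
    (ht : t ∈ φ.F E m n) : WA.wedge h' (φ.onΩ ξ) t ∈ φ.F E s r := by
  induction ht using Submodule.span_induction with
  | mem t ht =>
    obtain ⟨q, hq, ζ, η, e, rfl⟩ := ht
    rw [wedge_tw]
    refine Submodule.subset_span ⟨q, by omega, WB.mul h ξ ζ, η, e, ?_⟩
    congr 1
    exact WA.val_injective (by simp [mul_assoc])
  | zero => simp
  | add a b _ _ ha hb => rw [map_add]; exact add_mem ha hb
  | smul c a _ ha => rw [map_smul]; exact Submodule.smul_mem _ _ ha

lemma wedge_two_mem_F {q n : ℕ} (h : 2 + q = n) (ξ : WB.Ω 2) (t : WA.Tw E q) :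
    WA.wedge h (φ.onΩ ξ) t ∈ φ.F E 1 n := by
  have key : ∀ x : WB.Form, ∀ hx : x ∈ WB.deg 2,
      WA.wedge h (φ.onΩ (WB.homog x hx)) t ∈ φ.F E 1 n := by
    intro x hx
    have hx' : x ∈ WB.deg 1 * WB.deg 1 := by rw [WB.one_mul_deg 1]; exact hx
    induction hx' using Submodule.mul_induction_on' with
    | mem_mul_mem a ha b hb =>
      have e : φ.onΩ (WB.homog (a * b) hx)
          = WA.mul (show 1 + 1 = 2 from rfl) (φ.onΩ (WB.homog a ha)) (φ.onΩ (WB.homog b hb)) :=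
        WA.val_injective (by simp)
      rw [e, ← WA.wedge_wedge (show 1 + q = 1 + q from rfl) (by omega) rfl h]
      exact φ.wedge_mem_F _ _ _
    | add a ha b hb iha ihb =>
      rw [WB.one_mul_deg 1] at ha hb
      have e : WB.homog (a + b) hx = WB.homog a ha + WB.homog b hb := rfl
      rw [e, map_add, map_add, LinearMap.add_apply]
      exact add_mem (iha ha) (ihb hb)
  exact key ξ.1 ξ.2

lemma onΩ_dΩ {n m : ℕ} (h : n + 1 = m) (ξ : WB.Ω n) :
    WA.dΩ h (φ.onΩ ξ) = φ.onΩ (WB.dΩ h ξ) :=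
  WA.val_injective (by simp [φ.map_d])

lemma ext_mem_F_one (conn : WA.Connection E) {n m : ℕ} (h : n + 1 = m) {t : WA.Tw E n}
    (ht : t ∈ φ.F E 1 n) : conn.ext h t ∈ φ.F E 1 m := by
  induction ht using Submodule.span_induction with
  | mem t ht =>
    obtain ⟨q, hq, ξ, η, e, rfl⟩ := ht
    rw [← wedge_tw, conn.ext_wedge hq h rfl rfl (by omega) (by omega), φ.onΩ_dΩ]
    exact add_mem (φ.wedge_two_mem_F _ _ _) (Submodule.smul_mem _ _ (φ.wedge_mem_F _ _ _))
  | zero => simp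
  | add a b _ _ ha hb => rw [map_add]; exact add_mem ha hb
  | smul c a _ ha => rw [map_smul]; exact Submodule.smul_mem _ _ ha

variable (E) in
/-- `Ω^q A ⊗_A E`, regarded as a left `B`-module. -/
def TwB (_φ : DiffMap WB WA ι) (q : ℕ) : Type u := WA.Tw E q

instance (q : ℕ) : AddCommGroup (φ.TwB E q) := inferInstanceAs (AddCommGroup (WA.Tw E q))
instance (q : ℕ) : Module k (φ.TwB E q) := inferInstanceAs (Module k (WA.Tw E q))

/-- The action of `b ∈ B` on `Ω^q A ⊗_A E`, `b · (η ⊗ e) = ι(b) η ⊗ e`. -/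
def act {q : ℕ} (b : B) : WA.Tw E q →ₗ[k] WA.Tw E q :=
  WA.wedge (zero_add q) (φ.onΩ (WB.ofΩ b))

lemma act_one {q : ℕ} (x : WA.Tw E q) : φ.act 1 x = x := by
  have : φ.act 1 = (LinearMap.id : WA.Tw E q →ₗ[k] WA.Tw E q) := BalTensor.hom_ext (fun z e => by
    change WA.wedge (zero_add q) (φ.onΩ (WB.ofΩ 1)) (WA.tw z e) = WA.tw z e
    rw [wedge_tw]
    congr 1
    exact WA.val_injective (by simp))
  rw [this, LinearMap.id_apply]

lemma act_mul {q : ℕ} (a b : B) (x : WA.Tw E q) : φ.act (a * b) x = φ.act a (φ.act b x) := by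
  unfold act
  rw [WA.wedge_wedge (zero_add q) (zero_add q) (zero_add 0) (zero_add q)]
  congr 2
  exact WA.val_injective (by simp)

lemma act_add {q : ℕ} (a b : B) (x : WA.Tw E q) : φ.act (a + b) x = φ.act a x + φ.act b x := by
  unfold act
  rw [← LinearMap.add_apply, ← map_add]
  congr 2
  exact WA.val_injective (by simp)

lemma act_smul {q : ℕ} (c : k) (b : B) (x : WA.Tw E q) : φ.act (c • b) x = c • φ.act b x := by
  unfold act
  rw [← LinearMap.smul_apply, ← map_smul]
  congr 2
  exact WA.val_injective (by simp)

/-- The left `B`-module structure of `Ω^q A ⊗_A E`. -/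
instance (q : ℕ) : Module B (φ.TwB E q) where
  smul b x := φ.act (E := E) b x
  one_smul x := φ.act_one (E := E) x
  mul_smul a b x := φ.act_mul (E := E) a b x
  smul_zero a := map_zero (φ.act (E := E) a)
  smul_add a x y := map_add (φ.act (E := E) a) x y
  add_smul a b x := φ.act_add (E := E) a b x
  zero_smul x := by
    have h := φ.act_smul (E := E) (0 : k) (0 : B) x
    rw [zero_smul, zero_smul] at h
    exact h

instance (q : ℕ) : IsScalarTower k B (φ.TwB E q) where
  smul_assoc c b x := φ.act_smul (E := E) c b x

variable (E) in
/-- `ι_*Ω^1 B ∧ Ω^{q-1} A ⊗_A E` as a left `B`-submodule of `Ω^q A ⊗_A E`. -/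
def FoneB (q : ℕ) : Submodule B (φ.TwB E q) where
  carrier := (φ.F E 1 q : Set (WA.Tw E q))
  add_mem' hx hy := (φ.F E 1 q).add_mem hx hy
  zero_mem' := (φ.F E 1 q).zero_mem
  smul_mem' b _ hx := φ.wedge_F_mem (zero_add 1) (zero_add q) (WB.ofΩ b) hx

variable (E) in
/-- `M_{0,q} = (Ω^q A ⊗_A E) / (ι_*Ω^1 B ∧ Ω^{q-1} A ⊗_A E)`, a left `B`-module. -/
abbrev M (q : ℕ) : Type u := φ.TwB E q ⧸ φ.FoneB E q

/-- The class `[y]_{0,q} ∈ M_{0,q}` of `y ∈ Ω^q A ⊗_A E`. -/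
def mMk {q : ℕ} (y : WA.Tw E q) : φ.M E q := Submodule.Quotient.mk (p := φ.FoneB E q) y

lemma mMk_eq {q : ℕ} {x y : WA.Tw E q} : φ.mMk x = φ.mMk y ↔ x - y ∈ φ.F E 1 q := by
  have h : ∀ a b : φ.TwB E q, (Submodule.Quotient.mk a : φ.M E q) = Submodule.Quotient.mk b ↔
    a - b ∈ φ.FoneB E q := fun a b => Submodule.Quotient.eq (φ.FoneB E q)
  exact h x y

lemma mMk_eq_zero {q : ℕ} {y : WA.Tw E q} : φ.mMk y = 0 ↔ y ∈ φ.F E 1 q := by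
  have h : ∀ a : φ.TwB E q, (Submodule.Quotient.mk a : φ.M E q) = 0 ↔ a ∈ φ.FoneB E q :=
    fun a => Submodule.Quotient.mk_eq_zero (φ.FoneB E q)
  exact h y

lemma mMk_surjective {q : ℕ} : Function.Surjective (φ.mMk (E := E) (q := q)) :=
  Submodule.Quotient.mk_surjective (φ.FoneB E q)

lemma mMk_ext_eq (conn : WA.Connection E) {q : ℕ} {x y : WA.Tw E q} (h : x - y ∈ φ.F E 1 q) :
    φ.mMk (conn.ext (rfl : q + 1 = q + 1) x) = φ.mMk (conn.ext (rfl : q + 1 = q + 1) y) := by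
  refine φ.mMk_eq.2 ?_
  rw [← map_sub]
  exact φ.ext_mem_F_one conn rfl h

lemma act_ext_sub_mem (conn : WA.Connection E) {q : ℕ} (b : B) (y : WA.Tw E q) :
    conn.ext (rfl : q + 1 = q + 1) (φ.act b y) - φ.act b (conn.ext (rfl : q + 1 = q + 1) y)
      ∈ φ.F E 1 (q + 1) := by
  unfold act
  rw [conn.ext_wedge (zero_add q) rfl rfl (zero_add 1) (add_comm 1 q) (zero_add (q + 1)),
    pow_zero, one_smul, add_sub_cancel_right, φ.onΩ_dΩ]
  exact φ.wedge_mem_F _ _ _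

/-- The differential `[∇^{[q]}] : M_{0,q} → M_{0,q+1}`, `[y] ↦ [∇^{[q]} y]`; it is left
`B`-linear. -/
def dM (conn : WA.Connection E) (q : ℕ) : φ.M E q →ₗ[B] φ.M E (q + 1) where
  toFun := Quotient.lift (fun y : WA.Tw E q => φ.mMk (conn.ext (rfl : q + 1 = q + 1) y))
    (fun _ _ h => φ.mMk_ext_eq conn ((Submodule.quotientRel_def (φ.FoneB E q)).1 h))
  map_add' x y := by
    obtain ⟨x, rfl⟩ := φ.mMk_surjective x
    obtain ⟨y, rfl⟩ := φ.mMk_surjective y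
    exact congrArg φ.mMk (map_add (conn.ext rfl) x y)
  map_smul' b x := by
    obtain ⟨y, rfl⟩ := φ.mMk_surjective x
    exact φ.mMk_eq.2 (φ.act_ext_sub_mem conn b y)

@[simp] lemma dM_mMk (conn : WA.Connection E) {q : ℕ} (y : WA.Tw E q) :
    φ.dM conn q (φ.mMk y) = φ.mMk (conn.ext (rfl : q + 1 = q + 1) y) := rfl

/-- The coboundaries in `M_{0,q}`. -/
def imM (conn : WA.Connection E) : ∀ q : ℕ, Submodule B (φ.M E q)
  | 0 => ⊥
  | q + 1 => LinearMap.range (φ.dM conn q)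

/-- `Ĥ_q`, the cohomology at `M_{0,q}` of the complex of left `B`-modules `M_{0,*}`. -/
abbrev Hhat (conn : WA.Connection E) (q : ℕ) : Type u :=
  LinearMap.ker (φ.dM conn q) ⧸ (φ.imM conn q).submoduleOf (LinearMap.ker (φ.dM conn q))

/-- The class `⟨y⟩_{0,q} ∈ Ĥ_q` of `y ∈ Ω^q A ⊗_A E` with
`∇^{[q]} y ∈ ι_*Ω^1 B ∧ Ω^q A ⊗_A E`. -/
def hatMk (conn : WA.Connection E) {q : ℕ} (y : WA.Tw E q)
    (hy : conn.ext (rfl : q + 1 = q + 1) y ∈ φ.F E 1 (q + 1)) : φ.Hhat conn q :=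
  Submodule.Quotient.mk ⟨φ.mMk y, by
    rw [LinearMap.mem_ker, dM_mMk]; exact φ.mMk_eq_zero.2 hy⟩

/-- The linear relation between `Ω^{p+q} A ⊗_A E` and `Ω^p B ⊗_B Ĥ_q` spanned by the pairs
`(ι_*ξ ∧ y, ξ ⊗ ⟨y⟩_{0,q})`. -/
def symbolRel (conn : WA.Connection E) (p q : ℕ) :
    Submodule k (WA.Tw E (p + q) × WB.Tw (φ.Hhat conn q) p) :=
  Submodule.span k {t | ∃ (ξ : WB.Ω p) (y : WA.Tw E q)
    (hy : conn.ext (rfl : q + 1 = q + 1) y ∈ φ.F E 1 (q + 1)),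
    t = (WA.wedge rfl (φ.onΩ ξ) y, WB.tw ξ (φ.hatMk conn y hy))}

/-- The covariant derivative `∇_q` on `Ĥ_q` is the one induced by `∇`: for `x ∈ Ω^q A ⊗_A E`
representing a class in `Ĥ_q`, one has `∇_q⟨x⟩ = ∑ ηᵢ ⊗ ⟨yᵢ⟩`, where
`∇^{[q]} x = ∑ ι_*ηᵢ ∧ yᵢ` with `ηᵢ ∈ Ω^1 B` and `yᵢ` representing classes in `Ĥ_q`. -/
def IsInduced (conn : WA.Connection E) (q : ℕ) (nq : WB.Connection (φ.Hhat conn q)) : Prop :=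
  ∀ (x : WA.Tw E q) (hx : conn.ext (rfl : q + 1 = q + 1) x ∈ φ.F E 1 (q + 1)),
    (conn.ext (add_comm q 1) x, nq.toFun (φ.hatMk conn x hx)) ∈ φ.symbolRel conn 1 q

/-! ### The spectral sequence of the filtration -/

/-- `Z_r^{p,n-p} = F^p C^n ∩ d⁻¹(F^{p+r} C^{n+1})`, where `C^n = Ω^n A ⊗_A E`. -/
def Z (conn : WA.Connection E) (r p n : ℕ) : Submodule k (WA.Tw E n) :=
  φ.F E p n ⊓ (φ.F E (p + r) (n + 1)).comap (conn.ext rfl)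

/-- `B_r^{p,n-p} = F^p C^n ∩ d(F^{p-r} C^{n-1})`. Here `F^{p-r} C = C` for `p < r`, which is
also the value for the truncated subtraction since `F^0 C = C`. -/
def Bd (conn : WA.Connection E) (r p : ℕ) : ∀ n : ℕ, Submodule k (WA.Tw E n)
  | 0 => ⊥
  | n + 1 => φ.F E p (n + 1) ⊓ (φ.F E (p - r) n).map (conn.ext rfl)

/-- The filtration `F^p H^n(A; E, ∇)`: classes of cocycles lying in `F^p C^n`, i.e. the image of
`H^n(F^p C) → H^n(C)`. -/
def FH (conn : WA.Connection E) (p n : ℕ) : Submodule k (conn.Coh n) :=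
  ((φ.F E p n).submoduleOf (conn.cocycles n)).map conn.cohMk

open CategoryTheory in
/-- An identification of a first quadrant spectral sequence, with pages starting at `r = 1`, with
the spectral sequence of the filtered complex `F^* C`, `C^n = Ω^n A ⊗_A E`:
`E_r^{p,q} = Z_r^{p,q} / (Z_{r-1}^{p+1,q-1} + B_{r-1}^{p,q})` with `d_r` induced by `d`, and with
`H(E_r) ≅ E_{r+1}` sending the class of `[z]`, `z ∈ Z_{r+1}^{p,q} ⊆ Z_r^{p,q}`, to `[z]`. -/
structure FiltrationIdent (conn : WA.Connection E)
    (ss : CohomologicalSpectralSequenceNat (ModuleCat.{u} k) 1) where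
  /-- The quotient map `Z_r^{p,q} → E_r^{p,q}`. -/
  pr : ∀ (r : ℕ) (hr : 1 ≤ r) (p q : ℕ),
    φ.Z conn r p (p + q) →ₗ[k] (ss.page (r : ℤ) (by omega)).X (p, q)
  pr_surjective : ∀ r hr p q, Function.Surjective (pr r hr p q)
  ker_pr : ∀ r hr p q, LinearMap.ker (pr r hr p q) =
    (φ.Z conn (r - 1) (p + 1) (p + q) ⊔ φ.Bd conn (r - 1) p (p + q)).submoduleOf
      (φ.Z conn r p (p + q))
  d_pr : ∀ (r : ℕ) (hr : 1 ≤ r) (p q p' q' : ℕ) (hp : p + r = p') (hq : q' + r = q + 1)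
    (z : φ.Z conn r p (p + q)) (z' : φ.Z conn r p' (p' + q')),
    z'.1 = conn.ext (by omega) z.1 →
      ((ss.page (r : ℤ) (by omega)).d (p, q) (p', q')).hom (pr r hr p q z) = pr r hr p' q' z'
  iso_pr : ∀ (r : ℕ) (hr : 1 ≤ r) (p q : ℕ) (z : WA.Tw E (p + q))
    (hz : z ∈ φ.Z conn r p (p + q)) (hz' : z ∈ φ.Z conn (r + 1) p (p + q))
    (c : (ss.page (r : ℤ) (by omega)).cycles (p, q)),
    ((ss.page (r : ℤ) (by omega)).iCycles (p, q)).hom c = pr r hr p q ⟨z, hz⟩ →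
      (ss.iso (r : ℤ) ((r + 1 : ℕ) : ℤ) (p, q) (by omega) (by omega)).hom.hom
        (((ss.page (r : ℤ) (by omega)).homologyπ (p, q)).hom c) =
          pr (r + 1) (by omega) p q ⟨z, hz'⟩

open CategoryTheory in
/-- The second page is `E_2^{p,q} ≅ H^p(B; Ĥ_q, ∇_q)`, the isomorphism being induced by
`ι_*ξ ∧ y ↦ ξ ⊗ ⟨y⟩_{0,q}`. -/
def SecondPageIso (conn : WA.Connection E)
    {ss : CohomologicalSpectralSequenceNat (ModuleCat.{u} k) 1} (I : φ.FiltrationIdent conn ss)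
    (nq : ∀ q, WB.Connection (φ.Hhat conn q)) : Prop :=
  ∀ p q : ℕ, ∃ e : (ss.page ((2 : ℕ) : ℤ) (by omega)).X (p, q) ≃ₗ[k] (nq q).Coh p,
    ∀ (z : φ.Z conn 2 p (p + q)) (t : (nq q).cocycles p),
      (z.1, t.1) ∈ φ.symbolRel conn p q →
        e (I.pr 2 (by omega) p q z) = (nq q).cohMk t

open CategoryTheory in
/-- Convergence to `H^*(A; E, ∇)`: the filtration `F^p H^n` is decreasing with `F^0 H^n = H^n` and
`F^{n+1} H^n = 0`, and `E_∞^{p,q} ≅ F^p H^{p+q} / F^{p+1} H^{p+q}` by `[z] ↦ [z]`.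
Here `E_∞^{p,q}` is `E_r^{p,q}` for any `r > max(p, q + 1)`: from there on the differentials into
and out of position `(p, q)` leave the first quadrant. -/
def ConvergesToCoh (conn : WA.Connection E)
    {ss : CohomologicalSpectralSequenceNat (ModuleCat.{u} k) 1}
    (I : φ.FiltrationIdent conn ss) : Prop :=
  (∀ n, φ.FH conn 0 n = ⊤) ∧ (∀ n, φ.FH conn (n + 1) n = ⊥) ∧
  (∀ p n, φ.FH conn (p + 1) n ≤ φ.FH conn p n) ∧
  ∀ (p q r : ℕ) (hr : max p (q + 1) < r),
    ∃ e : (ss.page (r : ℤ) (by omega)).X (p, q) ≃ₗ[k]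
        φ.FH conn p (p + q) ⧸ (φ.FH conn (p + 1) (p + q)).submoduleOf (φ.FH conn p (p + q)),
      ∀ (z : φ.Z conn r p (p + q)) (hz : z.1 ∈ conn.cocycles (p + q))
        (w : φ.FH conn p (p + q)), w.1 = conn.cohMk ⟨z.1, hz⟩ →
          e (I.pr r (by omega) p q z) = Submodule.Quotient.mk w

end DiffMap

/-! ### Forms with coefficients in E: splitting off one-forms, and zero curvature. -/

namespace DiffCalculus

variable {k A : Type u} [Field k] [Ring A] [Algebra k A] (W : DiffCalculus k A)

/-! The spectral sequence of a filtered complex is formal; the hypotheses on `ι`, `E` and Ω^p B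
enter only in the induced connections and the second page.

Formal part. Zero curvature makes C a complex, the Leibniz rule makes each F^p C a subcomplex, and
F^0 C^n = C^n, F^{n+1} C^n = 0. One has H(E_r) ≅ E_{r+1} because Z_{r+1} maps onto the kernel of d_r
(`exists_cyclesToPage_eq`) and the part of it that lands in the image of d_r is the denominator of
E_{r+1} (`exists_pageD_eq_iff`). Since the filtration is finite in each degree, Z_r consists of
cocycles for large r, which gives convergence (`toPage_eq_zero_iff_ZtoFH_mem`).

Second page. The symbol ι_*ξ ∧ y ↦ ξ ⊗ [y] is a well-defined map from F^p C^n to Ω^p B ⊗_B M_{0,q}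
with kernel F^{p+1} C^n (`exists_symbol`): flatness of E embeds D_{p,q} ⊗_A E in C^n with image F^p
C^n, and the fibration condition recovers ξ ⊗ [η] from ι_*ξ ∧ η modulo D_{p+1,q-1}. On symbols d
acts as (-1)^p id ⊗ [∇] (`IsSymbol.ext`). Flatness of Ω^p B lets Ω^p B ⊗_B - commute with kernels
and images of [∇], so an element z of F^p C with dz in F^{p+1} C has a finer symbol in Ω^p B ⊗_B
Ĥ_q.

This finer symbol is handled as a linear relation `symRel`, spanned by the pairs (ι_*ξ ∧ y, ξ ⊗
⟨y⟩). It is functional (`symRel_zero`), every z as above is related to something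
(`exists_symRel_fst`), and the symbol vanishes exactly on F^{p+1} C^n + d(F^p C^{n-1})
(`symRel_eq_zero_iff`). Identities between symbols then follow by computing on generators and using
uniqueness. The derivative ∇_q⟨x⟩ is the symbol of ∇x, and d on the left of the relation corresponds
to ∇_q^{[p]} on the right (`IsInduced.ext_mem_symRel`). Hence d² = 0 forces zero curvature of ∇_q,
and cocycles and coboundaries for ∇_q correspond to Z_2 and to the denominator of E_2. -/

lemma deg_mul_one (n : ℕ) : W.deg n * W.deg 1 = W.deg (n + 1) := by
  induction n with
  | zero =>
    refine le_antisymm (Submodule.mul_le.2 fun x hx y hy => W.mul_mem' (zero_add 1) hx hy) ?_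
    intro x hx
    have h1 : (1 : W.Form) ∈ W.deg 0 := by simpa using W.of_mem 1
    simpa using Submodule.mul_mem_mul h1 hx
  -- The axiom splits off one-forms on the left only; associativity carries the splitting to the
  -- right end, as needed to compare F^{p+1} with F^p.
  | succ n ih => rw [← W.one_mul_deg n, mul_assoc, ih, W.one_mul_deg]

instance (n : ℕ) : IsScalarTower k Aᵐᵒᵖ (W.Ω n) where
  smul_assoc c a x := W.val_injective (by
    change W.val x * W.of (c • a.unop) = c • (W.val x * W.of a.unop)
    simp)

variable {W} {E : Type u} [AddCommGroup E] [Module k E] [Module A E]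

lemma wedge_one {n : ℕ} (t : W.Tw E n) : W.wedge (zero_add n) (W.ofΩ 1) t = t := by
  induction t using BalTensor.induction_on with
  | zero => simp
  | tmul z e =>
    change W.wedge (zero_add n) (W.ofΩ 1) (W.tw z e) = W.tw z e
    rw [wedge_tw]
    congr 1
    exact W.val_injective (by simp)
  | add a b ha hb => rw [map_add, ha, hb]

/-- On ω ⊗ e the two terms dω ∧ ∇e occur with signs (-1)^{n+1} and (-1)^n and cancel; what remains
is d²ω ⊗ e and ω ∧ ∇^{[1]}∇e, both zero. -/
lemma Connection.IsFlat.ext_ext {D : W.Connection E} (hD : D.IsFlat) {n m l : ℕ}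
    (h : n + 1 = m) (h' : m + 1 = l) (t : W.Tw E n) : D.ext h' (D.ext h t) = 0 := by
  induction t using BalTensor.induction_on with
  | zero => simp
  | tmul ω e =>
    change D.ext h' (D.ext h (W.tw ω e)) = 0
    have hdd : W.dΩ h' (W.dΩ h ω) = 0 := W.val_injective (by simp [W.d_d])
    rw [D.ext_tw, map_add, map_smul, D.ext_tw,
      D.ext_wedge h h' (rfl : 1 + 1 = 2) h h' (by omega), hD e, hdd]
    subst h
    simp [pow_succ, BalTensor.tmul]
  | add a b ha hb => rw [map_add, map_add, ha, hb, add_zero]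

end DiffCalculus

namespace DiffMap

open DiffCalculus

variable {k A B : Type u} [Field k] [Ring A] [Algebra k A] [Ring B] [Algebra k B]
    {WB : DiffCalculus k B} {WA : DiffCalculus k A} {ι : B →ₐ[k] A} (φ : DiffMap WB WA ι)
    {E : Type u} [AddCommGroup E] [Module k E] [Module A E]

/-! ### The filtered complex -/

/-- Induction on `F^m C^n`, with generators `ι_*ξ ∧ y`. -/
lemma F_induction {m n : ℕ} {P : WA.Tw E n → Prop}
    (wedge : ∀ (q : ℕ) (h : m + q = n) (ξ : WB.Ω m) (y : WA.Tw E q),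
      P (WA.wedge h (φ.onΩ ξ) y))
    (zero : P 0) (add : ∀ x y, P x → P y → P (x + y))
    {t : WA.Tw E n} (ht : t ∈ φ.F E m n) : P t := by
  -- `P` is not assumed stable under scalars; carrying c along lets it be absorbed into ξ on
  -- generators.
  suffices h : ∀ c : k, P (c • t) by simpa using h 1
  induction ht using Submodule.span_induction with
  | mem t ht =>
    obtain ⟨q, h, ξ, η, e, rfl⟩ := ht
    intro c
    have := wedge q h (c • ξ) (WA.tw η e)
    rwa [map_smul, map_smul, LinearMap.smul_apply, wedge_tw] at this
  | zero => intro c; rwa [smul_zero]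
  | add x y _ _ hx hy => intro c; rw [smul_add]; exact add _ _ (hx c) (hy c)
  | smul a x _ hx => intro c; rw [smul_smul]; exact hx _

lemma F_zero (n : ℕ) : φ.F E 0 n = ⊤ := by
  refine Submodule.eq_top_iff'.2 fun t => ?_
  have h := φ.wedge_mem_F (zero_add n) (WB.ofΩ 1) t
  have e : φ.onΩ (WB.ofΩ 1) = WA.ofΩ 1 := WA.val_injective (by simp)
  rwa [e, wedge_one] at h

lemma F_eq_bot {m n : ℕ} (h : n < m) : φ.F E m n = ⊥ := by
  refine (Submodule.eq_bot_iff _).2 fun t ht => ?_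
  exact φ.F_induction (P := fun t => t = 0) (fun q hq => by omega) rfl
    (fun x y hx hy => by rw [hx, hy, add_zero]) ht

/-- A form `ι_*ξ ∧ y` with `ξ ∈ Ω^{p+1} B` is a sum of forms `ι_*ζ ∧ (ι_*θ ∧ y)` with
`ζ ∈ Ω^p B` and `θ ∈ Ω^1 B`. -/
lemma wedge_succ_induction {p q q' n : ℕ} (hq : 1 + q = q') (h : p + q' = n)
    (h' : p + 1 + q = n) {P : WA.Tw E n → Prop}
    (wedge : ∀ (ζ : WB.Ω p) (θ : WB.Ω 1) (y : WA.Tw E q),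
      P (WA.wedge h (φ.onΩ ζ) (WA.wedge hq (φ.onΩ θ) y)))
    (add : ∀ x y, P x → P y → P (x + y)) (ξ : WB.Ω (p + 1)) (y : WA.Tw E q) :
    P (WA.wedge h' (φ.onΩ ξ) y) := by
  have key : ∀ x : WB.Form, ∀ _ : x ∈ WB.deg p * WB.deg 1, ∀ hx : x ∈ WB.deg (p + 1),
      P (WA.wedge h' (φ.onΩ (WB.homog x hx)) y) := by
    intro x hx'
    induction hx' using Submodule.mul_induction_on' with
    | mem_mul_mem a ha b hb =>
      intro hx
      have e : φ.onΩ (WB.homog (a * b) hx)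
          = WA.mul rfl (φ.onΩ (WB.homog a ha)) (φ.onΩ (WB.homog b hb)) :=
        WA.val_injective (by simp)
      rw [e, ← WA.wedge_wedge hq h rfl h']
      exact wedge _ _ _
    | add a ha b hb iha ihb =>
      intro hx
      rw [WB.deg_mul_one p] at ha hb
      have e : WB.homog (a + b) hx = WB.homog a ha + WB.homog b hb := rfl
      rw [e, map_add, map_add, LinearMap.add_apply]
      exact add _ _ (iha ha) (ihb hb)
  exact key ξ.1 (by rw [WB.deg_mul_one]; exact ξ.2) ξ.2

/-- Induction on `F^{p+1} C^n`, with generators `ι_*ζ ∧ y` for `ζ ∈ Ω^p B` and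
`y ∈ F^1 C^{n-p}`. -/
lemma F_succ_induction {p n : ℕ} {P : WA.Tw E n → Prop}
    (wedge : ∀ (q : ℕ) (h : p + q = n) (ζ : WB.Ω p) (y : WA.Tw E q),
      y ∈ φ.F E 1 q → P (WA.wedge h (φ.onΩ ζ) y))
    (zero : P 0) (add : ∀ x y, P x → P y → P (x + y))
    {t : WA.Tw E n} (ht : t ∈ φ.F E (p + 1) n) : P t :=
  φ.F_induction (fun q h ξ y => φ.wedge_succ_induction rfl (by omega) h
    (fun ζ θ y => wedge _ _ _ _ (φ.wedge_mem_F _ _ _)) add ξ y) zero add ht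

lemma F_succ_le (p n : ℕ) : φ.F E (p + 1) n ≤ φ.F E p n := fun _ ht =>
  φ.F_succ_induction (P := fun t => t ∈ φ.F E p n) (fun _ h ζ y _ => φ.wedge_mem_F h ζ y)
    (zero_mem _) (fun _ _ => add_mem) ht

lemma F_antitone (n : ℕ) : Antitone fun p => φ.F E p n :=
  antitone_nat_of_succ_le fun p => φ.F_succ_le p n

/-- By Leibniz, d(ι_*ξ ∧ y) = ι_*(dξ) ∧ y ± ι_*ξ ∧ ∇y; the first term even lies one filtration step
deeper, so only the second survives in the associated graded. -/
lemma ext_mem_F (conn : WA.Connection E) {p n m : ℕ} (h : n + 1 = m) {t : WA.Tw E n}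
    (ht : t ∈ φ.F E p n) : conn.ext h t ∈ φ.F E p m := by
  refine φ.F_induction (P := fun t => conn.ext h t ∈ φ.F E p m) (fun q hq ξ y => ?_) (by simp)
    (fun x y hx hy => by rw [map_add]; exact add_mem hx hy) ht
  rw [conn.ext_wedge hq h rfl rfl (by omega) (by omega), φ.onΩ_dΩ]
  exact add_mem (φ.F_succ_le _ _ (φ.wedge_mem_F _ _ _))
    (Submodule.smul_mem _ _ (φ.wedge_mem_F _ _ _))

/-- `d(F^j C^{n-1}) ⊆ C^n`. -/
def dF (conn : WA.Connection E) (j : ℕ) : ∀ n : ℕ, Submodule k (WA.Tw E n)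
  | 0 => ⊥
  | n + 1 => (φ.F E j n).map (conn.ext rfl)

variable {φ} {conn : WA.Connection E}

lemma ext_mem_dF {j n m : ℕ} (h : n + 1 = m) {w : WA.Tw E n} (hw : w ∈ φ.F E j n) :
    conn.ext h w ∈ φ.dF conn j m := by
  subst h
  exact ⟨w, hw, rfl⟩

lemma dF_induction {j n : ℕ} {P : WA.Tw E n → Prop} (zero : P 0)
    (ext : ∀ m (h : m + 1 = n), ∀ w ∈ φ.F E j m, P (conn.ext h w)) {t : WA.Tw E n}
    (ht : t ∈ φ.dF conn j n) : P t := by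
  cases n with
  | zero => rw [(Submodule.mem_bot k).1 ht]; exact zero
  | succ n =>
    obtain ⟨w, hw, rfl⟩ := ht
    exact ext n rfl w hw

lemma exists_of_mem_dF {j n m : ℕ} (h : n + 1 = m) {t : WA.Tw E m} (ht : t ∈ φ.dF conn j m) :
    ∃ w ∈ φ.F E j n, conn.ext h w = t := by
  subst h
  exact ht

lemma dF_le_F (j n : ℕ) : φ.dF conn j n ≤ φ.F E j n := fun _ ht =>
  dF_induction (P := fun t => t ∈ φ.F E j n) (zero_mem _)
    (fun _ h _ hw => φ.ext_mem_F conn h hw) ht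

lemma dF_antitone (n : ℕ) : Antitone fun j => φ.dF conn j n := fun _ _ hij _ ht =>
  dF_induction (P := fun t => t ∈ φ.dF conn _ n) (zero_mem _)
    (fun _ h _ hw => ext_mem_dF h (φ.F_antitone _ hij hw)) ht

lemma ext_dF (hconn : conn.IsFlat) {j n m : ℕ} (h : n + 1 = m) {t : WA.Tw E n}
    (ht : t ∈ φ.dF conn j n) : conn.ext h t = 0 :=
  dF_induction (P := fun t => conn.ext h t = 0) (map_zero _)
    (fun _ h' w _ => hconn.ext_ext h' h w) ht

lemma dF_zero (n : ℕ) : φ.dF conn 0 n = conn.coboundaries n := by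
  cases n with
  | zero => rfl
  | succ n =>
    change (φ.F E 0 n).map _ = LinearMap.range _
    rw [F_zero, LinearMap.range_eq_map]

/-- Gives boundaries a description uniform in n, so that degree 0 needs no separate treatment later.
-/
lemma Bd_eq (r p n : ℕ) : φ.Bd conn r p n = φ.F E p n ⊓ φ.dF conn (p - r) n := by
  cases n with
  | zero => exact inf_bot_eq _ |>.symm
  | succ n => rfl

lemma mem_Bd {r p n : ℕ} {t : WA.Tw E n} :
    t ∈ φ.Bd conn r p n ↔ t ∈ φ.F E p n ∧ t ∈ φ.dF conn (p - r) n := by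
  rw [Bd_eq, Submodule.mem_inf]

lemma mem_Z {r p n m : ℕ} (h : n + 1 = m) {t : WA.Tw E n} :
    t ∈ φ.Z conn r p n ↔ t ∈ φ.F E p n ∧ conn.ext h t ∈ φ.F E (p + r) m := by
  subst h
  rfl

lemma mem_cocycles {n m : ℕ} (h : n + 1 = m) {t : WA.Tw E n} :
    t ∈ conn.cocycles n ↔ conn.ext h t = 0 := by
  subst h
  rfl

end DiffMap

/-! ### Linear algebra -/

/-- Both the second page and the limit page are identified this way: two surjections out of the same
Z_r with equal kernels. -/
lemma exists_linearEquiv_of_ker_eq {k V X Y : Type*} [Ring k] [AddCommGroup V] [Module k V]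
    [AddCommGroup X] [Module k X] [AddCommGroup Y] [Module k Y] (f : V →ₗ[k] X) (g : V →ₗ[k] Y)
    (hf : Function.Surjective f) (hg : Function.Surjective g) (h : ∀ v, f v = 0 ↔ g v = 0) :
    ∃ e : X ≃ₗ[k] Y, ∀ v, e (f v) = g v := by
  have hk : LinearMap.ker f = LinearMap.ker g := Submodule.ext h
  refine ⟨(f.quotKerEquivOfSurjective hf).symm.trans
    ((Submodule.quotEquivOfEq _ _ hk).trans (g.quotKerEquivOfSurjective hg)), fun v => ?_⟩
  have : (f.quotKerEquivOfSurjective hf).symm (f v) = Submodule.Quotient.mk v :=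
    (LinearEquiv.symm_apply_eq _).2 rfl
  rw [LinearEquiv.trans_apply, this]
  rfl

open CategoryTheory in
/-- If `ψ : V → S.X₂` has image the cycles of `S`, then the homology of `S` is any quotient of `V`
by the preimage of the boundaries. -/
lemma exists_homologyIso {k : Type u} [Field k] (S : ShortComplex (ModuleCat.{u} k))
    {V H : Type u} [AddCommGroup V] [Module k V] [AddCommGroup H] [Module k H]
    (ψ : V →ₗ[k] S.X₂) (ρ : V →ₗ[k] H) (hg : ∀ v, S.g.hom (ψ v) = 0)
    (hψ : ∀ x : S.X₂, S.g.hom x = 0 → ∃ v, ψ v = x) (hρ : Function.Surjective ρ)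
    (hf : ∀ v, (∃ y, S.f.hom y = ψ v) ↔ ρ v = 0) :
    ∃ e : S.homology ≅ ModuleCat.of k H, ∀ (v : V) (c : S.cycles),
      S.iCycles.hom c = ψ v → e.hom.hom (S.homologyπ.hom c) = ρ v := by
  let ψ' : V →ₗ[k] LinearMap.ker S.g.hom := ψ.codRestrict _ hg
  obtain ⟨e, he⟩ := exists_linearEquiv_of_ker_eq
    ((LinearMap.range S.moduleCatToCycles).mkQ.comp ψ') ρ
    ((Submodule.mkQ_surjective _).comp fun x => by
      obtain ⟨v, hv⟩ := hψ x.1 x.2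
      exact ⟨v, Subtype.ext hv⟩) hρ (fun v => by
      rw [← hf, LinearMap.comp_apply, Submodule.mkQ_apply, Submodule.Quotient.mk_eq_zero]
      exact ⟨fun ⟨y, hy⟩ => ⟨y, congrArg Subtype.val hy⟩, fun ⟨y, hy⟩ => ⟨y, Subtype.ext hy⟩⟩)
  refine ⟨S.moduleCatHomologyIso ≪≫ e.toModuleIso, fun v c hc => ?_⟩
  have h1 : S.moduleCatCyclesIso.hom.hom c = ψ' v := by
    apply Subtype.ext
    have := S.moduleCatCyclesIso_hom_i_apply c
    exact this.trans hc
  have h2 := S.π_moduleCatCyclesIso_hom_apply c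
  change e (S.moduleCatHomologyIso.hom.hom (S.homologyπ.hom c)) = ρ v
  rw [← he v]
  congr 1
  refine h2.trans ?_
  change (LinearMap.range S.moduleCatToCycles).mkQ (S.moduleCatCyclesIso.hom.hom c) = _
  rw [h1]
  rfl

namespace DiffMap

open DiffCalculus

variable {k A B : Type u} [Field k] [Ring A] [Algebra k A] [Ring B] [Algebra k B]
    {WB : DiffCalculus k B} {WA : DiffCalculus k A} {ι : B →ₐ[k] A} {φ : DiffMap WB WA ι}
    {E : Type u} [AddCommGroup E] [Module k E] [Module A E] {conn : WA.Connection E}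

/-! ### The spectral sequence of the filtered complex -/

variable (φ conn) in
/-- `E_r^{p,n-p} = Z_r^{p,n-p} / (Z_{r-1}^{p+1,n-p-1} + B_{r-1}^{p,n-p})`. -/
abbrev Page (r p n : ℕ) : Type u :=
  φ.Z conn r p n ⧸
    (φ.Z conn (r - 1) (p + 1) n ⊔ φ.Bd conn (r - 1) p n).submoduleOf (φ.Z conn r p n)

variable (φ conn) in
/-- The quotient map `Z_r^{p,n-p} → E_r^{p,n-p}`. -/
def toPage (r p n : ℕ) : φ.Z conn r p n →ₗ[k] φ.Page conn r p n := Submodule.mkQ _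

lemma toPage_surjective (r p n : ℕ) : Function.Surjective (φ.toPage conn r p n) :=
  Submodule.mkQ_surjective _

lemma ker_toPage (r p n : ℕ) : LinearMap.ker (φ.toPage conn r p n) =
    (φ.Z conn (r - 1) (p + 1) n ⊔ φ.Bd conn (r - 1) p n).submoduleOf (φ.Z conn r p n) :=
  Submodule.ker_mkQ _

lemma toPage_eq_zero {r p n : ℕ} {z : φ.Z conn r p n} : φ.toPage conn r p n z = 0 ↔
    ∃ u ∈ φ.Z conn (r - 1) (p + 1) n, ∃ b ∈ φ.Bd conn (r - 1) p n, u + b = z.1 := by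
  rw [← LinearMap.mem_ker, ker_toPage]
  exact Submodule.mem_sup

lemma Z_mono_succ (r p n : ℕ) : φ.Z conn (r + 1) p n ≤ φ.Z conn r p n := fun _ h =>
  ⟨h.1, φ.F_antitone _ (Nat.le_succ (p + r)) h.2⟩

lemma ext_mem_Z (hconn : conn.IsFlat) {r p p' n m : ℕ} (hp : p + r = p') (h : n + 1 = m)
    (s : ℕ) {z : WA.Tw E n} (hz : z ∈ φ.Z conn r p n) : conn.ext h z ∈ φ.Z conn s p' m := by
  rw [mem_Z h, hp] at hz
  refine (mem_Z rfl).2 ⟨hz.2, ?_⟩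
  rw [hconn.ext_ext]
  exact zero_mem _

/-- Makes d_r well defined: the B_{r-1} part is killed by d² = 0, and d carries Z_{r-1}^{p+1} into
B_{r-1}^{p+r}, since p + r - (r - 1) = p + 1. -/
lemma ext_sup_mem (hconn : conn.IsFlat) {r p p' n m : ℕ} (hr : 1 ≤ r) (hp : p + r = p')
    (h : n + 1 = m) {z : WA.Tw E n}
    (hz : z ∈ φ.Z conn (r - 1) (p + 1) n ⊔ φ.Bd conn (r - 1) p n) :
    conn.ext h z ∈ φ.Z conn (r - 1) (p' + 1) m ⊔ φ.Bd conn (r - 1) p' m := by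
  obtain ⟨u, hu, b, hb, rfl⟩ := Submodule.mem_sup.1 hz
  rw [map_add, ext_dF hconn h (mem_Bd.1 hb).2, add_zero]
  have hu' := (mem_Z h).1 hu
  refine Submodule.mem_sup_right (mem_Bd.2 ⟨?_, ext_mem_dF h ?_⟩)
  · rw [← hp, show p + r = p + 1 + (r - 1) by omega]
    exact hu'.2
  · rw [show p' - (r - 1) = p + 1 by omega]
    exact hu'.1

/-- The differential `d_r : E_r^{p,n-p} → E_r^{p+r,n-p-r+1}`. -/
def pageD (hconn : conn.IsFlat) {r p p' n m : ℕ} (hr : 1 ≤ r) (hp : p + r = p')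
    (h : n + 1 = m) : φ.Page conn r p n →ₗ[k] φ.Page conn r p' m :=
  Submodule.mapQ _ _
    ((conn.ext h).restrict fun _ hz => ext_mem_Z (φ := φ) hconn hp h r hz)
    fun _ hz => ext_sup_mem hconn hr hp h hz

lemma pageD_toPage (hconn : conn.IsFlat) {r p p' n m : ℕ} (hr : 1 ≤ r) (hp : p + r = p')
    (h : n + 1 = m) (z : φ.Z conn r p n) (z' : φ.Z conn r p' m) (hz : z'.1 = conn.ext h z.1) :
    pageD hconn hr hp h (φ.toPage conn r p n z) = φ.toPage conn r p' m z' := by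
  have : z' = (conn.ext h).restrict (fun _ hz => ext_mem_Z (φ := φ) hconn hp h r hz) z :=
    Subtype.ext hz
  rw [this]
  rfl

lemma pageD_pageD (hconn : conn.IsFlat) {r p p' p'' n m l : ℕ} (hr : 1 ≤ r) (hp : p + r = p')
    (hp' : p' + r = p'') (h : n + 1 = m) (h' : m + 1 = l) (x : φ.Page conn r p n) :
    pageD hconn hr hp' h' (pageD hconn hr hp h x) = 0 := by
  obtain ⟨z, rfl⟩ := toPage_surjective _ _ _ x
  rw [pageD_toPage hconn hr hp h z ⟨_, ext_mem_Z hconn hp h r z.2⟩ rfl,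
    pageD_toPage hconn hr hp' h' _ 0 (hconn.ext_ext h h' z.1).symm, map_zero]

variable (φ conn) in
/-- `Z_{r+1}^{p,n-p} ⊆ Z_r^{p,n-p} → E_r^{p,n-p}`. -/
def cyclesToPage (r p n : ℕ) : φ.Z conn (r + 1) p n →ₗ[k] φ.Page conn r p n :=
  (φ.toPage conn r p n).comp (Submodule.inclusion (Z_mono_succ r p n))

lemma cyclesToPage_apply {r p n : ℕ} (z : φ.Z conn (r + 1) p n) :
    φ.cyclesToPage conn r p n z = φ.toPage conn r p n ⟨z.1, Z_mono_succ r p n z.2⟩ := rfl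

/-- For z in Z_{r+1}^p the differential dz is closed and lies in F^{p+r+1}, hence in the summand
Z_{r-1}^{p+r+1} of the target's denominator. -/
lemma pageD_cyclesToPage (hconn : conn.IsFlat) {r p p' n m : ℕ} (hr : 1 ≤ r) (hp : p + r = p')
    (h : n + 1 = m) (z : φ.Z conn (r + 1) p n) :
    pageD hconn hr hp h (φ.cyclesToPage conn r p n z) = 0 := by
  rw [cyclesToPage_apply, pageD_toPage hconn hr hp h _
    ⟨_, ext_mem_Z hconn hp h r (Z_mono_succ r p n z.2)⟩ rfl, toPage_eq_zero]
  refine ⟨conn.ext h z.1, (mem_Z rfl).2 ⟨?_, ?_⟩, 0, zero_mem _, add_zero _⟩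
  · rw [← hp]
    exact ((mem_Z h).1 z.2).2
  · rw [hconn.ext_ext]
    exact zero_mem _

/-- If d_r[z] = 0, then dz = u + dw with u in F^{p+r+1} and w in F^{p+1}. Replacing z by z - w puts
it in Z_{r+1}, and w lies in Z_{r-1}^{p+1}, so the class on page r is unchanged. -/
lemma exists_cyclesToPage_eq (hconn : conn.IsFlat) {r p p' n m : ℕ} (hr : 1 ≤ r)
    (hp : p + r = p') (h : n + 1 = m) (x : φ.Page conn r p n) (hx : pageD hconn hr hp h x = 0) :
    ∃ z, φ.cyclesToPage conn r p n z = x := by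
  obtain ⟨z, rfl⟩ := toPage_surjective _ _ _ x
  rw [pageD_toPage hconn hr hp h _ ⟨_, ext_mem_Z hconn hp h r z.2⟩ rfl, toPage_eq_zero] at hx
  obtain ⟨u, hu, b, hb, hub⟩ := hx
  change u + b = conn.ext h z.1 at hub
  obtain ⟨w, hw, rfl⟩ := exists_of_mem_dF h (mem_Bd.1 hb).2
  rw [show p' - (r - 1) = p + 1 by omega] at hw
  have hz := (mem_Z h).1 z.2
  have hwZ : w ∈ φ.Z conn (r - 1) (p + 1) n := by
    refine (mem_Z h).2 ⟨hw, ?_⟩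
    rw [show p + 1 + (r - 1) = p' by omega]
    exact (mem_Bd.1 hb).1
  have hmem : z.1 - w ∈ φ.Z conn (r + 1) p n := by
    refine (mem_Z h).2 ⟨sub_mem hz.1 (φ.F_succ_le _ _ hw), ?_⟩
    rw [map_sub, ← hub, add_sub_cancel_right, ← add_assoc, hp]
    exact hu.1
  refine ⟨⟨z.1 - w, hmem⟩, ?_⟩
  rw [cyclesToPage_apply, ← sub_eq_zero, ← map_sub, toPage_eq_zero]
  refine ⟨-w, neg_mem hwZ, 0, zero_mem _, ?_⟩
  change -w + 0 = (z.1 - w) - z.1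
  abel

/-- If `d_r` on `E_r^{p,n-p}` leaves the first quadrant, then all elements are cycles. -/
lemma cyclesToPage_surjective {r p n : ℕ} (hr : n + 1 < p + r) :
    Function.Surjective (φ.cyclesToPage conn r p n) := by
  intro x
  obtain ⟨z, rfl⟩ := toPage_surjective _ _ _ x
  refine ⟨⟨z.1, (mem_Z rfl).2 ⟨((mem_Z rfl).1 z.2).1, ?_⟩⟩, rfl⟩
  have := ((mem_Z rfl).1 z.2).2
  rw [F_eq_bot φ hr, Submodule.mem_bot] at this
  rw [this]
  exact zero_mem _

/-- This bridges the denominators of consecutive pages: a correction term in Z_{r-1}^{p+1} improves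
to Z_r^{p+1} once its differential is that of an element of Z_{r+1}^p. -/
lemma mem_Z_of_ext_eq {r p n : ℕ} {u z : WA.Tw E n}
    (hu : u ∈ φ.Z conn (r - 1) (p + 1) n) (hz : z ∈ φ.Z conn (r + 1) p n)
    (h : conn.ext rfl u = conn.ext rfl z) : u ∈ φ.Z conn r (p + 1) n := by
  refine (mem_Z rfl).2 ⟨((mem_Z rfl).1 hu).1, ?_⟩
  rw [h, show p + 1 + r = p + (r + 1) by omega]
  exact ((mem_Z rfl).1 hz).2

/-- If [z] = d_r[v], then z - dv = u + b in the denominator of page r, and u improves to Z_r while b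
+ dv lies in B_r. Conversely, z = u + dw with w in F^p makes w an element of Z_r^p with d_r[w] =
[z]. -/
lemma exists_pageD_eq_iff (hconn : conn.IsFlat) {r p p' n m : ℕ} (hr : 1 ≤ r)
    (hp : p + r = p') (h : n + 1 = m) (z : φ.Z conn (r + 1) p' m) :
    (∃ y, pageD hconn hr hp h y = φ.cyclesToPage conn r p' m z) ↔
      φ.toPage conn (r + 1) p' m z = 0 := by
  rw [toPage_eq_zero, Nat.add_sub_cancel]
  constructor
  · rintro ⟨y, hy⟩
    obtain ⟨v, rfl⟩ := toPage_surjective _ _ _ y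
    have hv := (mem_Z h).1 v.2
    rw [pageD_toPage hconn hr hp h _ ⟨_, ext_mem_Z hconn hp h r v.2⟩ rfl, cyclesToPage_apply,
      ← sub_eq_zero, ← neg_eq_zero, ← map_sub, ← map_neg, toPage_eq_zero] at hy
    obtain ⟨u, hu, b, hb, hub⟩ := hy
    have hub' : u + b = -(conn.ext h v.1 - z.1) := hub
    have hz : z.1 = u + (b + conn.ext h v.1) := by rw [← add_assoc, hub']; abel
    have hb2 : b ∈ φ.dF conn (p' - r) m := dF_antitone m (by omega) (mem_Bd.1 hb).2
    refine ⟨u, mem_Z_of_ext_eq hu z.2 ?_, b + conn.ext h v.1, mem_Bd.2 ⟨?_, ?_⟩, hz.symm⟩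
    · rw [hz, map_add, map_add, ext_dF hconn rfl hb2, hconn.ext_ext, add_zero, add_zero]
    · exact add_mem (mem_Bd.1 hb).1 (hp ▸ hv.2)
    · refine add_mem hb2 (ext_mem_dF h ?_)
      rw [show p' - r = p by omega]
      exact hv.1
  · rintro ⟨u, hu, b, hb, hub⟩
    have hb' := mem_Bd.1 hb
    obtain ⟨w, hw, rfl⟩ := exists_of_mem_dF h hb'.2
    rw [show p' - r = p by omega] at hw
    refine ⟨φ.toPage conn r p n ⟨w, (mem_Z h).2 ⟨hw, hp.symm ▸ hb'.1⟩⟩, ?_⟩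
    rw [pageD_toPage hconn hr hp h _ ⟨_, ext_mem_Z hconn hp h r
      ((mem_Z h).2 ⟨hw, hp.symm ▸ hb'.1⟩)⟩ rfl, cyclesToPage_apply, ← sub_eq_zero,
      ← neg_eq_zero, ← map_sub, ← map_neg, toPage_eq_zero]
    have hu' := (mem_Z rfl).1 hu
    refine ⟨u, (mem_Z rfl).2 ⟨hu'.1, φ.F_antitone _ (by omega) hu'.2⟩, 0, zero_mem _, ?_⟩
    change u + 0 = -(conn.ext h w - z.1)
    rw [← hub]
    abel

/-- If `d_r` into `E_r^{p,n-p}` comes from outside the first quadrant, then there are no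
boundaries. -/
lemma cyclesToPage_eq_zero_iff (hconn : conn.IsFlat) {r p n : ℕ} (hr : 1 ≤ r) (hp : p < r)
    (z : φ.Z conn (r + 1) p n) :
    φ.cyclesToPage conn r p n z = 0 ↔ φ.toPage conn (r + 1) p n z = 0 := by
  rw [toPage_eq_zero, cyclesToPage_apply, toPage_eq_zero, Nat.add_sub_cancel]
  -- For p < r both subtractions truncate to 0: the boundaries have already stabilised.
  have hB : φ.Bd conn (r - 1) p n = φ.Bd conn r p n := by
    rw [Bd_eq, Bd_eq, show p - (r - 1) = p - r by omega]
  rw [hB]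
  constructor
  · rintro ⟨u, hu, b, hb, hub⟩
    refine ⟨u, mem_Z_of_ext_eq hu z.2 ?_, b, hb, hub⟩
    rw [← hub, map_add, ext_dF hconn rfl (mem_Bd.1 hb).2, add_zero]
  · rintro ⟨u, hu, b, hb, hub⟩
    have hu' := (mem_Z rfl).1 hu
    exact ⟨u, (mem_Z rfl).2 ⟨hu'.1, φ.F_antitone _ (by omega) hu'.2⟩, b, hb, hub⟩

end DiffMap

/-! ### The pages as complexes and their assembly into a spectral sequence. -/

namespace DiffMap

open DiffCalculus CategoryTheory

variable {k A B : Type u} [Field k] [Ring A] [Algebra k A] [Ring B] [Algebra k B]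
    {WB : DiffCalculus k B} {WA : DiffCalculus k A} {ι : B →ₐ[k] A} {φ : DiffMap WB WA ι}
    {E : Type u} [AddCommGroup E] [Module k E] [Module A E] {conn : WA.Connection E}

variable (φ) in
/-- The differential of `E_r` between arbitrary positions, zero unless it has bidegree
`(r, 1 - r)`. -/
def pageHom (hconn : conn.IsFlat) (r : ℕ) (hr : 1 ≤ r) (i j : ℕ × ℕ) :
    φ.Page conn r i.1 (i.1 + i.2) →ₗ[k] φ.Page conn r j.1 (j.1 + j.2) :=
  if h : i.1 + r = j.1 ∧ j.2 + r = i.2 + 1 then pageD hconn hr h.1 (by omega) else 0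

lemma pageHom_comp (hconn : conn.IsFlat) (r : ℕ) (hr : 1 ≤ r) (i j l : ℕ × ℕ) :
    (φ.pageHom hconn r hr j l).comp (φ.pageHom hconn r hr i j) = 0 := by
  unfold pageHom
  by_cases h1 : i.1 + r = j.1 ∧ j.2 + r = i.2 + 1
  · by_cases h2 : j.1 + r = l.1 ∧ l.2 + r = j.2 + 1
    · rw [dif_pos h1, dif_pos h2]
      refine LinearMap.ext fun x => ?_
      rw [LinearMap.comp_apply, LinearMap.zero_apply, pageD_pageD]
    · rw [dif_neg h2, LinearMap.zero_comp]
  · rw [dif_neg h1, LinearMap.comp_zero]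

variable (φ) in
/-- The page `E_r` as a complex, `r ≥ 1`. -/
noncomputable def pageComplex (hconn : conn.IsFlat) (s : ℤ) (r : ℕ) (hr : 1 ≤ r) (hs : s = r) :
    HomologicalComplex (ModuleCat.{u} k) (ComplexShape.spectralSequenceNat ⟨s, 1 - s⟩) where
  X i := ModuleCat.of k (φ.Page conn r i.1 (i.1 + i.2))
  d i j := ModuleCat.ofHom (φ.pageHom hconn r hr i j)
  shape i j hij := congrArg ModuleCat.ofHom <| dif_neg fun h => hij (by
    rw [ComplexShape.spectralSequenceNat_rel_iff]
    dsimp only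
    omega)
  d_comp_d' i j l _ _ := congrArg ModuleCat.ofHom (pageHom_comp hconn r hr i j l)

lemma pageComplex_d (hconn : conn.IsFlat) {s : ℤ} {r : ℕ} (hr : 1 ≤ r) (hs : s = r)
    {i j : ℕ × ℕ}
    (h : i.1 + r = j.1) (h' : j.2 + r = i.2 + 1) :
    (φ.pageComplex hconn s r hr hs).d i j =
      ModuleCat.ofHom (pageD hconn hr h (by omega)) :=
  congrArg ModuleCat.ofHom (dif_pos ⟨h, h'⟩)

lemma pageComplex_d_eq_zero (hconn : conn.IsFlat) {s : ℤ} {r : ℕ} (hr : 1 ≤ r) (hs : s = r)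
    {i j : ℕ × ℕ} (h : ¬ (i.1 + r = j.1 ∧ j.2 + r = i.2 + 1)) :
    (φ.pageComplex hconn s r hr hs).d i j = 0 :=
  congrArg ModuleCat.ofHom (dif_neg h)

/-- `ComplexShape.next` returns its argument when there is no successor, so the case where d_r
leaves the first quadrant has to be separated from the genuine one. -/
lemma pageComplex_next {s : ℤ} {r : ℕ} (hs : s = r) (i : ℕ × ℕ) :
    (i.1 + r = ((ComplexShape.spectralSequenceNat ⟨s, 1 - s⟩).next i).1 ∧
      ((ComplexShape.spectralSequenceNat ⟨s, 1 - s⟩).next i).2 + r = i.2 + 1) ∨ i.2 + 1 < r := by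
  by_cases h : i.2 + 1 < r
  · exact Or.inr h
  · have hrel : (ComplexShape.spectralSequenceNat ⟨s, 1 - s⟩).Rel i (i.1 + r, i.2 + 1 - r) := by
      rw [ComplexShape.spectralSequenceNat_rel_iff]
      dsimp only
      omega
    rw [ComplexShape.next_eq' _ hrel]
    left
    dsimp only
    omega

lemma pageComplex_prev {s : ℤ} {r : ℕ} (hr : 1 ≤ r) (hs : s = r) (i : ℕ × ℕ) :
    (((ComplexShape.spectralSequenceNat ⟨s, 1 - s⟩).prev i).1 + r = i.1 ∧
      i.2 + r = ((ComplexShape.spectralSequenceNat ⟨s, 1 - s⟩).prev i).2 + 1) ∨ i.1 < r := by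
  by_cases h : i.1 < r
  · exact Or.inr h
  · have hrel : (ComplexShape.spectralSequenceNat ⟨s, 1 - s⟩).Rel (i.1 - r, i.2 + r - 1) i := by
      rw [ComplexShape.spectralSequenceNat_rel_iff]
      dsimp only
      omega
    rw [ComplexShape.prev_eq' _ hrel]
    left
    dsimp only
    omega

/-- Inside the quadrant this is the kernel and image computation for d_r. At its edges a missing
outgoing differential makes every class a cycle, and a missing incoming one leaves no boundaries. -/
lemma exists_pageComplex_iso (hconn : conn.IsFlat) {s : ℤ} {r : ℕ} (hr : 1 ≤ r) (hs : s = r)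
    (i : ℕ × ℕ) :
    ∃ e : (φ.pageComplex hconn s r hr hs).homology i ≅
        ModuleCat.of k (φ.Page conn (r + 1) i.1 (i.1 + i.2)),
      ∀ (z : φ.Z conn (r + 1) i.1 (i.1 + i.2)) (c : (φ.pageComplex hconn s r hr hs).cycles i),
        ((φ.pageComplex hconn s r hr hs).iCycles i).hom c =
            φ.cyclesToPage conn r i.1 (i.1 + i.2) z →
          e.hom.hom (((φ.pageComplex hconn s r hr hs).homologyπ i).hom c) =
            φ.toPage conn (r + 1) i.1 (i.1 + i.2) z := by
  refine exists_homologyIso ((φ.pageComplex hconn s r hr hs).sc i)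
    (φ.cyclesToPage conn r i.1 (i.1 + i.2)) (φ.toPage conn (r + 1) i.1 (i.1 + i.2)) ?_ ?_
    (toPage_surjective _ _ _) ?_
  · intro z
    change ((φ.pageComplex hconn s r hr hs).d i _).hom _ = 0
    by_cases h : i.1 + r = ((ComplexShape.spectralSequenceNat ⟨s, 1 - s⟩).next i).1 ∧
      ((ComplexShape.spectralSequenceNat ⟨s, 1 - s⟩).next i).2 + r = i.2 + 1
    · rw [pageComplex_d hconn hr hs h.1 h.2]
      exact pageD_cyclesToPage hconn hr h.1 _ z
    · rw [pageComplex_d_eq_zero hconn hr hs h]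
      rfl
  · intro x hx
    change ((φ.pageComplex hconn s r hr hs).d i _).hom x = 0 at hx
    rcases pageComplex_next hs i with h | h
    · rw [pageComplex_d hconn hr hs h.1 h.2] at hx
      exact exists_cyclesToPage_eq hconn hr h.1 _ x hx
    · exact cyclesToPage_surjective (by omega) x
  · intro z
    change (∃ y, ((φ.pageComplex hconn s r hr hs).d _ i).hom y = _) ↔ _
    by_cases h : ((ComplexShape.spectralSequenceNat ⟨s, 1 - s⟩).prev i).1 + r = i.1 ∧
      i.2 + r = ((ComplexShape.spectralSequenceNat ⟨s, 1 - s⟩).prev i).2 + 1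
    · rw [pageComplex_d hconn hr hs h.1 h.2]
      exact exists_pageD_eq_iff hconn hr h.1 _ z
    · rw [pageComplex_d_eq_zero hconn hr hs h,
        ← cyclesToPage_eq_zero_iff hconn hr ((pageComplex_prev hr hs i).resolve_left h)]
      exact ⟨fun ⟨_, hy⟩ => hy.symm, fun hz => ⟨0, hz.symm⟩⟩

variable (φ) in
/-- The spectral sequence of the filtered complex `F^* C`. -/
noncomputable def filtrationSS (hconn : conn.IsFlat) :
    CohomologicalSpectralSequenceNat (ModuleCat.{u} k) 1 where
  page s hs := φ.pageComplex hconn s s.toNat (by omega) (by omega)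
  iso s s' i hss hs := (exists_pageComplex_iso hconn _ _ i).choose ≪≫
    -- The integer index s' equals s + 1 only propositionally, so the page has to be transported.
    eqToIso (by
      change _ = ModuleCat.of k (φ.Page conn s'.toNat i.1 (i.1 + i.2))
      rw [show s'.toNat = s.toNat + 1 by omega])

variable (φ) in
/-- The identification of `filtrationSS` as the spectral sequence of the filtration. -/
noncomputable def filtrationIdent (hconn : conn.IsFlat) :
    φ.FiltrationIdent conn (φ.filtrationSS hconn) where
  pr r _ p q := φ.toPage conn r p (p + q)
  pr_surjective r _ p q := toPage_surjective r p (p + q)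
  ker_pr r _ p q := ker_toPage r p (p + q)
  d_pr r hr p q p' q' hp hq z z' hz := by
    change ((φ.pageComplex hconn (r : ℤ) r hr rfl).d (p, q) (p', q')).hom _ = _
    rw [pageComplex_d (i := (p, q)) (j := (p', q')) hconn hr rfl hp hq]
    exact pageD_toPage hconn hr hp (by omega) z z' hz
  iso_pr r hr p q z hz hz' c hc :=
    -- For casts of natural numbers `toNat` reduces and the transport in `filtrationSS` is
    -- definitionally the identity.
    (exists_pageComplex_iso hconn hr (rfl : (r : ℤ) = r) (p, q)).choose_spec ⟨z, hz'⟩ c hc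

end DiffMap

namespace DiffMap

open DiffCalculus

variable {k A B : Type u} [Field k] [Ring A] [Algebra k A] [Ring B] [Algebra k B]
    {WB : DiffCalculus k B} {WA : DiffCalculus k A} {ι : B →ₐ[k] A} {φ : DiffMap WB WA ι}
    {E : Type u} [AddCommGroup E] [Module k E] [Module A E] {conn : WA.Connection E}

/-! ### Convergence -/

lemma cohMk_eq_zero {n : ℕ} {z : conn.cocycles n} :
    conn.cohMk z = 0 ↔ z.1 ∈ conn.coboundaries n :=
  Submodule.Quotient.mk_eq_zero ((conn.coboundaries n).submoduleOf (conn.cocycles n))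

lemma cohMk_surjective (n : ℕ) : Function.Surjective (conn.cohMk (n := n)) :=
  Submodule.mkQ_surjective _

lemma mem_FH {p n : ℕ} {x : conn.Coh n} :
    x ∈ φ.FH conn p n ↔ ∃ z : conn.cocycles n, z.1 ∈ φ.F E p n ∧ conn.cohMk z = x := Iff.rfl

lemma FH_zero (n : ℕ) : φ.FH conn 0 n = ⊤ := by
  refine Submodule.eq_top_iff'.2 fun x => ?_
  obtain ⟨z, rfl⟩ := cohMk_surjective n x
  exact mem_FH.2 ⟨z, by rw [F_zero]; trivial, rfl⟩

lemma FH_eq_bot (n : ℕ) : φ.FH conn (n + 1) n = ⊥ := by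
  refine (Submodule.eq_bot_iff _).2 fun x hx => ?_
  obtain ⟨z, hz, rfl⟩ := mem_FH.1 hx
  rw [F_eq_bot φ n.lt_succ_self, Submodule.mem_bot] at hz
  rw [cohMk_eq_zero, hz]
  exact zero_mem _

lemma FH_succ_le (p n : ℕ) : φ.FH conn (p + 1) n ≤ φ.FH conn p n := by
  intro x hx
  obtain ⟨z, hz, rfl⟩ := mem_FH.1 hx
  exact mem_FH.2 ⟨z, φ.F_succ_le p n hz, rfl⟩

/-- Here dz lies in F^{p+r} C^{n+1}, which is zero since p + r > n + 1. -/
lemma mem_cocycles_of_mem_Z {r p n : ℕ} (hr : n + 1 < p + r) {z : WA.Tw E n}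
    (hz : z ∈ φ.Z conn r p n) : z ∈ conn.cocycles n := by
  have := ((mem_Z rfl).1 hz).2
  rwa [F_eq_bot φ hr, Submodule.mem_bot] at this

/-- The map `Z_r^{p,n-p} → F^p H^n`, `z ↦ [z]`, for large `r`. -/
def ZtoFH {r p n : ℕ} (hr : n + 1 < p + r) : φ.Z conn r p n →ₗ[k] φ.FH conn p n :=
  (conn.cohMk.comp (Submodule.inclusion fun _ hz =>
    mem_cocycles_of_mem_Z (φ := φ) hr hz)).codRestrict _ fun z => mem_FH.2 ⟨⟨z.1, mem_cocycles_of_mem_Z hr z.2⟩, ((mem_Z rfl).1 z.2).1, rfl⟩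

lemma ZtoFH_surjective {r p n : ℕ} (hr : n + 1 < p + r) :
    Function.Surjective (ZtoFH (φ := φ) (conn := conn) hr) := by
  rintro ⟨x, hx⟩
  obtain ⟨z, hz, rfl⟩ := mem_FH.1 hx
  refine ⟨⟨z.1, (mem_Z rfl).2 ⟨hz, ?_⟩⟩, rfl⟩
  rw [(mem_cocycles rfl).1 z.2]
  exact zero_mem _

/-- For such r the denominator of E_r consists of the cocycles in F^{p+1} plus all coboundaries in
F^p: the index p - (r - 1) truncates to 0, and u in Z_{r-1}^{p+1} is closed because p + 1 + (r - 1)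
= p + r. -/
lemma toPage_eq_zero_iff_ZtoFH_mem {r p n : ℕ} (hr : n + 1 < p + r) (hp : p < r)
    (z : φ.Z conn r p n) :
    φ.toPage conn r p n z = 0 ↔ (ZtoFH hr z).1 ∈ φ.FH conn (p + 1) n := by
  have hz0 := (mem_Z rfl).1 z.2
  rw [toPage_eq_zero, mem_FH]
  constructor
  · rintro ⟨u, hu, b, hb, hub⟩
    have hu0 : u ∈ conn.cocycles n := mem_cocycles_of_mem_Z (by omega) hu
    refine ⟨⟨u, hu0⟩, ((mem_Z rfl).1 hu).1, ?_⟩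
    change conn.cohMk _ = conn.cohMk _
    rw [← sub_eq_zero, ← map_sub, cohMk_eq_zero, ← dF_zero (φ := φ)]
    have hb' := (mem_Bd.1 hb).2
    rw [show p - (r - 1) = 0 by omega] at hb'
    change u - z.1 ∈ _
    rw [← hub, sub_add_cancel_left]
    exact neg_mem hb'
  · rintro ⟨u, hu, huz⟩
    change conn.cohMk _ = conn.cohMk _ at huz
    rw [eq_comm, ← sub_eq_zero, ← map_sub, cohMk_eq_zero, ← dF_zero (φ := φ)] at huz
    refine ⟨u.1, (mem_Z rfl).2 ⟨hu, ?_⟩, z.1 - u.1, mem_Bd.2 ⟨?_, ?_⟩, by abel⟩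
    · rw [(mem_cocycles rfl).1 u.2]
      exact zero_mem _
    · exact sub_mem hz0.1 (φ.F_succ_le _ _ hu)
    · rw [show p - (r - 1) = 0 by omega]
      exact huz

lemma convergesToCoh (hconn : conn.IsFlat) :
    φ.ConvergesToCoh conn (φ.filtrationIdent hconn) := by
  refine ⟨FH_zero, FH_eq_bot, FH_succ_le, fun p q r hr => ?_⟩
  have h1 : p + q + 1 < p + r := by omega
  obtain ⟨e, he⟩ := exists_linearEquiv_of_ker_eq (φ.toPage conn r p (p + q))
    (((φ.FH conn (p + 1) (p + q)).submoduleOf (φ.FH conn p (p + q))).mkQ.comp (ZtoFH h1))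
    (toPage_surjective _ _ _) ((Submodule.mkQ_surjective _).comp (ZtoFH_surjective h1)) (by
      intro z
      rw [toPage_eq_zero_iff_ZtoFH_mem h1 (by omega), LinearMap.comp_apply, Submodule.mkQ_apply,
        Submodule.Quotient.mk_eq_zero]
      rfl)
  refine ⟨e, fun z hz w hw => (he z).trans ?_⟩
  rw [LinearMap.comp_apply, Submodule.mkQ_apply]
  congr 1
  exact Subtype.ext hw.symm

end DiffMap

/-! ### Descent along surjections, and functoriality of balanced tensor products. -/

lemma exists_linearMap_of_surjective {k V X Y : Type*} [Ring k] [AddCommGroup V] [Module k V]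
    [AddCommGroup X] [Module k X] [AddCommGroup Y] [Module k Y] (π : V →ₗ[k] X) (f : V →ₗ[k] Y)
    (hπ : Function.Surjective π) (h : ∀ v, π v = 0 → f v = 0) :
    ∃ g : X →ₗ[k] Y, ∀ v, g (π v) = f v := by
  refine ⟨((LinearMap.ker π).liftQ f h).comp
    (π.quotKerEquivOfSurjective hπ).symm.toLinearMap, fun v => ?_⟩
  have : (π.quotKerEquivOfSurjective hπ).symm (π v) = Submodule.Quotient.mk v :=
    (LinearEquiv.symm_apply_eq _).2 rfl
  rw [LinearMap.comp_apply, LinearEquiv.coe_coe, this]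
  rfl

lemma LeftFlat.rTensor_subtype_injective {k R N Y : Type u} [Field k] [Ring R] [Algebra k R]
    [AddCommGroup N] [Module k N] [Module R N] (hN : LeftFlat k R N) [AddCommGroup Y] [Module k Y]
    [Module Rᵐᵒᵖ Y] [IsScalarTower k Rᵐᵒᵖ Y] (X : Submodule Rᵐᵒᵖ Y) :
    Function.Injective (BalTensor.rTensor (k := k) (R := R) N (X.subtype.restrictScalars k)
      fun a x => map_smul X.subtype (op a) x) :=
  (hN X Y (Y ⧸ X) (X.subtype.restrictScalars k) (X.mkQ.restrictScalars k)
    (fun a x => map_smul X.subtype (op a) x) (fun a x => map_smul X.mkQ (op a) x)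
    X.subtype_injective (LinearMap.exact_subtype_mkQ X) X.mkQ_surjective).1

namespace BalTensor

lemma tmul_zero {k R M N : Type u} [Field k] [Ring R] [AddCommGroup M] [Module k M]
    [Module Rᵐᵒᵖ M] [AddCommGroup N] [Module k N] [Module R N] (m : M) :
    tmul k R m (0 : N) = 0 := by simp [tmul]

variable {k R M N N' N'' : Type u} [Field k] [Ring R] [Algebra k R] [AddCommGroup M] [Module k M]
    [Module Rᵐᵒᵖ M] [AddCommGroup N] [Module k N] [Module R N] [IsScalarTower k R N]
    [AddCommGroup N'] [Module k N'] [Module R N'] [IsScalarTower k R N']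
    [AddCommGroup N''] [Module k N''] [Module R N''] [IsScalarTower k R N'']

variable (k M) in
/-- `id ⊗ g` for an `R`-linear map `g`. -/
def mapRight (g : N →ₗ[R] N') : BalTensor k R M N →ₗ[k] BalTensor k R M N' :=
  lTensor M (g.restrictScalars k) g.map_smul

@[simp] lemma mapRight_tmul (g : N →ₗ[R] N') (m : M) (n : N) :
    mapRight k M g (tmul k R m n) = tmul k R m (g n) := rfl

lemma mapRight_comp (g : N →ₗ[R] N') (g' : N' →ₗ[R] N'') (t : BalTensor k R M N) :
    mapRight k M (g'.comp g) t = mapRight k M g' (mapRight k M g t) := by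
  have : mapRight k M (g'.comp g) = (mapRight k M g').comp (mapRight k M g) :=
    hom_ext fun _ _ => rfl
  rw [this, LinearMap.comp_apply]

end BalTensor

namespace DiffMap

open DiffCalculus

variable {k A B : Type u} [Field k] [Ring A] [Algebra k A] [Ring B] [Algebra k B]
    {WB : DiffCalculus k B} {WA : DiffCalculus k A} {ι : B →ₐ[k] A} {φ : DiffMap WB WA ι}
    {E : Type u} [AddCommGroup E] [Module k E] [Module A E] {conn : WA.Connection E}

/-! ### The symbol map -/

lemma D_le_deg {p q n : ℕ} (h : p + q = n) : φ.D p q ≤ WA.deg n := by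
  refine Submodule.mul_le.2 ?_
  rintro _ ⟨x, hx, rfl⟩ y hy
  exact WA.mul_mem' h (φ.map_deg p x hx) hy

lemma mul_of_mem_D {p q : ℕ} {x : WA.Form} (hx : x ∈ φ.D p q) (a : A) :
    x * WA.of a ∈ φ.D p q := by
  have h := Submodule.mul_mem_mul hx (WA.of_mem a)
  rw [D, mul_assoc] at h
  exact mul_le_mul' le_rfl
    (Submodule.mul_le.2 fun x hx y hy => WA.mul_mem' (add_zero q) hx hy) h

variable (φ) in
/-- `D_{p,q}` as a right `A`-submodule of `Ω^n A`, `n = p + q`. -/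
def DRight (p q n : ℕ) : Submodule Aᵐᵒᵖ (WA.Ω n) where
  carrier := {x | WA.val x ∈ φ.D p q}
  add_mem' hx hy := by
    change WA.val (_ + _) ∈ φ.D p q
    rw [map_add]
    exact add_mem (S := Submodule k WA.Form) hx hy
  zero_mem' := by
    change WA.val 0 ∈ φ.D p q
    rw [map_zero]
    exact zero_mem _
  smul_mem' a _ hx := mul_of_mem_D hx a.unop

lemma mul_onΩ_mem_DRight {p q n : ℕ} (h : p + q = n) (ξ : WB.Ω p) (η : WA.Ω q) :
    WA.mul h (φ.onΩ ξ) η ∈ φ.DRight p q n :=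
  Submodule.mul_mem_mul ⟨_, WB.val_mem ξ, rfl⟩ (WA.val_mem η)

/-- A product of submodules is additively generated by products, so neither a scalar nor a zero case
is needed. -/
lemma DRight_induction {p q n : ℕ} (h : p + q = n) {P : φ.DRight p q n → Prop}
    (mul : ∀ (ξ : WB.Ω p) (η : WA.Ω q),
      P ⟨WA.mul h (φ.onΩ ξ) η, mul_onΩ_mem_DRight h ξ η⟩)
    (add : ∀ x y, P x → P y → P (x + y)) (x : φ.DRight p q n) : P x := by
  have key : ∀ y : WA.Form, ∀ hy : y ∈ φ.D p q, P ⟨WA.homog y (D_le_deg h hy), hy⟩ := by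
    intro y hy
    induction hy using Submodule.mul_induction_on' with
    | mem_mul_mem m hm n hn =>
      obtain ⟨m, hm, rfl⟩ := hm
      exact mul (WB.homog m hm) (WA.homog n hn)
    | add x hx y hy ihx ihy => exact add _ _ ihx ihy
  exact key _ x.2

/-- `D_{p,q} → N_{p,q}`. -/
def DRightToN (p q n : ℕ) : φ.DRight p q n →ₗ[k] φ.N p q where
  toFun x := Submodule.Quotient.mk (p := φ.DnextSub p q) ⟨WA.val x.1, x.2⟩
  map_add' _ _ := rfl
  map_smul' _ _ := rfl

/-- `D_{p,q}` consists of forms of degree `n = p + q`. -/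
def DModToΩ {p q n : ℕ} (h : p + q = n) : φ.DMod p q →ₗ[k] WA.Ω n where
  toFun x := WA.homog x.1 (D_le_deg h x.2)
  map_add' _ _ := rfl
  map_smul' _ _ := rfl

lemma tw_mem_F {p q n : ℕ} (h : p + q = n) {x : WA.Ω n} (hx : WA.val x ∈ φ.D p q) (e : E) :
    WA.tw x e ∈ φ.F E p n :=
  DRight_induction (φ := φ) h (P := fun x => WA.tw x.1 e ∈ φ.F E p n)
    (fun ξ η => φ.wedge_mem_F h ξ (WA.tw η e))
    (fun x y hx hy => by
      change BalTensor.tmul k A (x.1 + y.1) e ∈ _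
      rw [BalTensor.add_tmul]
      exact add_mem hx hy) ⟨x, hx⟩

variable (φ) in
/-- The left `B`-linear map `Ω^q A → Ω^q A ⊗_A E`, `η ↦ η ⊗ e`. -/
def DModTensor (q : ℕ) (e : E) : φ.DMod 0 q →ₗ[B] φ.TwB E q where
  toFun x := WA.tw (DModToΩ (zero_add q) x) e
  map_add' x y := by
    change BalTensor.tmul k A _ e = BalTensor.tmul k A _ e + BalTensor.tmul k A _ e
    rw [map_add, BalTensor.add_tmul]
    rfl
  map_smul' _ _ := rfl

variable (φ) in
/-- The left `B`-linear map `N_{0,q} → M_{0,q}`, `[η] ↦ [η ⊗ e]`. -/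
def NtoM (q : ℕ) (e : E) : φ.N 0 q →ₗ[B] φ.M E q :=
  Submodule.mapQ _ _ (φ.DModTensor q e) (by
    intro x hx
    change WA.tw (DModToΩ (zero_add q) x) e ∈ φ.F E 1 q
    -- For q = 0 the submodule divided out of N_{0,q} is zero by convention; otherwise it is
    -- D_{1,q-1}.
    cases q with
    | zero =>
      have : x = 0 := Subtype.ext hx
      rw [this, map_zero]
      simp [tw, BalTensor.tmul]
    | succ q => exact tw_mem_F (add_comm 1 q) (x := DModToΩ (zero_add (q + 1)) x) hx e)

lemma NtoM_mk {q : ℕ} (e : E) (x : φ.DMod 0 q) :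
    φ.NtoM q e (Submodule.Quotient.mk x) = φ.mMk (WA.tw (DModToΩ (zero_add q) x) e) := rfl

variable (φ E) in
/-- `mMk` as a `k`-linear map. -/
def mMkL (q : ℕ) : WA.Tw E q →ₗ[k] φ.M E q where
  toFun := φ.mMk
  map_add' _ _ := rfl
  map_smul' _ _ := rfl

lemma NtoM_add {q : ℕ} (e e' : E) (x : φ.N 0 q) :
    φ.NtoM q (e + e') x = φ.NtoM q e x + φ.NtoM q e' x := by
  obtain ⟨x, rfl⟩ := Submodule.Quotient.mk_surjective _ x
  rw [NtoM_mk, NtoM_mk, NtoM_mk, tw, BalTensor.tmul_add]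
  rfl

lemma NtoM_smul {q : ℕ} (c : k) (e : E) (x : φ.N 0 q) :
    φ.NtoM q (c • e) x = c • φ.NtoM q e x := by
  obtain ⟨x, rfl⟩ := Submodule.Quotient.mk_surjective _ x
  rw [NtoM_mk, NtoM_mk, tw, BalTensor.tmul_smul]
  rfl

lemma mapRight_NtoM_add {p q : ℕ} (e e' : E) (t : WB.Tw (φ.N 0 q) p) :
    BalTensor.mapRight k (WB.Ω p) (φ.NtoM q (e + e')) t =
      BalTensor.mapRight k (WB.Ω p) (φ.NtoM q e) t +
        BalTensor.mapRight k (WB.Ω p) (φ.NtoM q e') t := by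
  rw [← LinearMap.add_apply]
  congr 1
  refine BalTensor.hom_ext fun m n => ?_
  rw [LinearMap.add_apply, BalTensor.mapRight_tmul, BalTensor.mapRight_tmul,
    BalTensor.mapRight_tmul, NtoM_add, BalTensor.tmul_add]

lemma mapRight_NtoM_smul {p q : ℕ} (c : k) (e : E) (t : WB.Tw (φ.N 0 q) p) :
    BalTensor.mapRight k (WB.Ω p) (φ.NtoM q (c • e)) t =
      c • BalTensor.mapRight k (WB.Ω p) (φ.NtoM q e) t := by
  rw [← LinearMap.smul_apply]
  congr 1
  refine BalTensor.hom_ext fun m n => ?_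
  rw [LinearMap.smul_apply, BalTensor.mapRight_tmul, BalTensor.mapRight_tmul, NtoM_smul,
    BalTensor.tmul_smul]

/-- The symbol map on `D_{p,q} ⊗_A E`. -/
lemma exists_symbol_DRight (hφ : φ.IsFibration) {p q n : ℕ} (h : p + q = n) :
    ∃ s : BalTensor k A (φ.DRight p q n) E →ₗ[k] WB.Tw (φ.M E q) p,
      ∀ (ξ : WB.Ω p) (η : WA.Ω q) (e : E),
        s (BalTensor.tmul k A ⟨WA.mul h (φ.onΩ ξ) η, mul_onΩ_mem_DRight h ξ η⟩ e) =
          WB.tw ξ (φ.mMk (WA.tw η e)) := by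
  obtain ⟨f, hf⟩ := hφ p q
  let s₀ : φ.DRight p q n →ₗ[k] E →ₗ[k] WB.Tw (φ.M E q) p :=
    -- The inverse of the fibration isomorphism turns [ι_*ξ ∧ η] into ξ ⊗ [η]; then [η] ↦ [η ⊗ e] is
    -- applied in the second factor.
    LinearMap.mk₂ k (fun x e => BalTensor.mapRight k (WB.Ω p) (φ.NtoM q e)
        (f.symm (DRightToN p q n x)))
      (fun x x' e => by rw [map_add, map_add, map_add])
      (fun c x e => by rw [map_smul, map_smul, map_smul])
      (fun x e e' => mapRight_NtoM_add e e' _)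
      (fun c x e => mapRight_NtoM_smul c e _)
  have hs₀ : ∀ (ξ : WB.Ω p) (η : WA.Ω q) (e : E),
      s₀ ⟨WA.mul h (φ.onΩ ξ) η, mul_onΩ_mem_DRight h ξ η⟩ e =
        WB.tw ξ (φ.mMk (WA.tw η e)) := by
    intro ξ η e
    have hη : WA.val η ∈ φ.D 0 q := by
      have := mul_onΩ_mem_DRight (φ := φ) (zero_add q) (WB.ofΩ 1) η
      change WA.val _ ∈ φ.D 0 q at this
      simpa using this
    have h1 : f.symm (DRightToN p q n ⟨WA.mul h (φ.onΩ ξ) η, mul_onΩ_mem_DRight h ξ η⟩) =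
        BalTensor.tmul k B ξ (Submodule.Quotient.mk (p := φ.DnextSub 0 q) ⟨WA.val η, hη⟩) :=
      (LinearEquiv.symm_apply_eq f).2 (hf ξ ⟨WA.val η, hη⟩).symm
    change BalTensor.mapRight k (WB.Ω p) (φ.NtoM q e) _ = _
    rw [h1, BalTensor.mapRight_tmul]
    rfl
  refine ⟨BalTensor.lift s₀ fun x a e => ?_, hs₀⟩
  -- The fibration isomorphism is only `k`-linear, so A-balancedness is checked on generators, where
  -- right multiplication by a acts on η alone.
  induction x using DRight_induction h with
  | mul ξ η =>
    have h1 := hs₀ ξ (op a • η) e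
    have h2 : WA.tw (op a • η) e = WA.tw η (a • e) := BalTensor.smul_tmul' η a e
    rw [h2] at h1
    refine Eq.trans ?_ (h1.trans (hs₀ ξ η (a • e)).symm)
    congr 2
    exact Subtype.ext (WA.val_injective (by simp [mul_assoc]))
  | add x y hx hy =>
    rw [smul_add, map_add, map_add, LinearMap.add_apply, LinearMap.add_apply, hx, hy]

/-- By flatness of `E`, the map `D_{p,q} ⊗_A E → Ω^n A ⊗_A E` is injective. -/
lemma exists_DRight_tensor_injective (hE : LeftFlat k A E) (p q n : ℕ) :
    ∃ j : BalTensor k A (φ.DRight p q n) E →ₗ[k] WA.Tw E n,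
      Function.Injective j ∧ ∀ x e, j (BalTensor.tmul k A x e) = WA.tw x.1 e := by
  exact ⟨BalTensor.rTensor E ((φ.DRight p q n).subtype.restrictScalars k)
    fun a x => map_smul (φ.DRight p q n).subtype (op a) x,
    hE.rTensor_subtype_injective (φ.DRight p q n), fun _ _ => rfl⟩

/-- `σ` is the symbol map `ι_*ξ ∧ y ↦ ξ ⊗ [y]` on `F^p C^n`. -/
def IsSymbol {p q n : ℕ} (h : p + q = n) (σ : φ.F E p n →ₗ[k] WB.Tw (φ.M E q) p) : Prop :=
  ∀ (ξ : WB.Ω p) (y : WA.Tw E q),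
    σ ⟨WA.wedge h (φ.onΩ ξ) y, φ.wedge_mem_F h ξ y⟩ = WB.tw ξ (φ.mMk y)

/-- F^p C^n lies in the image of D_{p,q} ⊗_A E, and by flatness of E this tensor product embeds in
C^n; so the symbol, defined on the tensor product, descends to F^p C^n. -/
lemma exists_symbol_aux (hφ : φ.IsFibration) (hE : LeftFlat k A E) {p q n : ℕ}
    (h : p + q = n) :
    ∃ σ : φ.F E p n →ₗ[k] WB.Tw (φ.M E q) p, IsSymbol h σ := by
  obtain ⟨s, hs⟩ := exists_symbol_DRight (E := E) hφ h
  obtain ⟨j, hj, hjt⟩ := exists_DRight_tensor_injective (φ := φ) hE p q n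
  have hjs : ∀ (ξ : WB.Ω p) (y : WA.Tw E q), ∃ t, j t = WA.wedge h (φ.onΩ ξ) y ∧
      s t = WB.tw ξ (φ.mMk y) := by
    intro ξ y
    induction y using BalTensor.induction_on with
    | zero => exact ⟨0, by simp, by rw [map_zero]; exact (BalTensor.tmul_zero ξ).symm⟩
    | tmul η e => exact ⟨_, hjt _ _, hs ξ η e⟩
    | add x y hx hy =>
      obtain ⟨t, ht, ht'⟩ := hx
      obtain ⟨u, hu, hu'⟩ := hy
      refine ⟨t + u, by rw [map_add, map_add, ht, hu], ?_⟩
      rw [map_add, ht', hu', ← BalTensor.tmul_add]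
      rfl
  have hle : φ.F E p n ≤ LinearMap.range j := fun t ht => by
    refine φ.F_induction (P := fun t => t ∈ LinearMap.range j) (fun q' hq ξ y => ?_)
      (zero_mem _) (fun _ _ => add_mem) ht
    obtain rfl : q' = q := by omega
    obtain ⟨t, ht, -⟩ := hjs ξ y
    exact ⟨t, ht⟩
  refine ⟨s.comp ((LinearEquiv.ofInjective j hj).symm.toLinearMap.comp (Submodule.inclusion hle)),
    fun ξ y => ?_⟩
  obtain ⟨t, ht, ht'⟩ := hjs ξ y
  rw [← ht']
  exact congrArg s ((LinearEquiv.symm_apply_eq _).2 (Subtype.ext ht.symm))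

/-- Composed with the symbol map, this gives the projection to C^n / F^{p+1} C^n, so the kernel of
the symbol is no larger than F^{p+1} C^n. It is well defined because ι_*ξ ∧ F^1 C lies in F^{p+1} C.
-/
lemma exists_symbol_inverse {p q n : ℕ} (h : p + q = n) :
    ∃ g : WB.Tw (φ.M E q) p →ₗ[k] WA.Tw E n ⧸ φ.F E (p + 1) n,
      ∀ (ξ : WB.Ω p) (y : WA.Tw E q),
        g (WB.tw ξ (φ.mMk y)) = (φ.F E (p + 1) n).mkQ (WA.wedge h (φ.onΩ ξ) y) := by
  obtain ⟨g₀, hg₀⟩ := exists_linearMap_of_surjective (φ.mMkL E q)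
    (((WA.wedge h).comp φ.onΩ).compr₂ (φ.F E (p + 1) n).mkQ).flip φ.mMk_surjective (by
      intro y hy
      refine LinearMap.ext fun ξ => (Submodule.Quotient.mk_eq_zero _).2 ?_
      exact φ.wedge_F_mem rfl h ξ (φ.mMk_eq_zero.1 hy))
  let g : WB.Tw (φ.M E q) p →ₗ[k] WA.Tw E n ⧸ φ.F E (p + 1) n :=
    BalTensor.lift g₀.flip fun ξ b x => by
      obtain ⟨y, rfl⟩ := φ.mMk_surjective x
      have h1 := LinearMap.congr_fun (hg₀ y) (op b • ξ)
      have h2 := LinearMap.congr_fun (hg₀ (φ.act b y)) ξ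
      refine h1.trans (Eq.trans ?_ h2.symm)
      change (φ.F E (p + 1) n).mkQ (WA.wedge h (φ.onΩ (op b • ξ)) y) =
        (φ.F E (p + 1) n).mkQ (WA.wedge h (φ.onΩ ξ) (φ.act b y))
      rw [act, WA.wedge_wedge (zero_add q) h (add_zero p) h]
      congr 3
      exact WA.val_injective (by simp)
  exact ⟨g, fun ξ y => LinearMap.congr_fun (hg₀ y) ξ⟩

/-- The symbol map `F^p C^n → Ω^p B ⊗_B M_{0,q}`, `ι_*ξ ∧ y ↦ ξ ⊗ [y]`, with kernel
`F^{p+1} C^n`. -/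
lemma exists_symbol (hφ : φ.IsFibration) (hE : LeftFlat k A E) {p q n : ℕ} (h : p + q = n) :
    ∃ σ : φ.F E p n →ₗ[k] WB.Tw (φ.M E q) p,
      IsSymbol h σ ∧
      ∀ t : φ.F E p n, σ t = 0 ↔ t.1 ∈ φ.F E (p + 1) n := by
  obtain ⟨σ, hσ⟩ := exists_symbol_aux hφ hE h
  refine ⟨σ, hσ, fun t => ⟨fun ht => ?_, fun ht => ?_⟩⟩
  · obtain ⟨g, hg₀⟩ := exists_symbol_inverse (φ := φ) (E := E) h
    -- The membership proof is part of the induction predicate, because the symbol is defined only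
    -- on F^p C^n.
    have hg : ∀ t (ht : t ∈ φ.F E p n),
        ∃ ht : t ∈ φ.F E p n, g (σ ⟨t, ht⟩) = (φ.F E (p + 1) n).mkQ t := fun t ht => by
      refine φ.F_induction (P := fun t => ∃ ht : t ∈ φ.F E p n,
        g (σ ⟨t, ht⟩) = (φ.F E (p + 1) n).mkQ t) (fun q' hq ξ y => ?_)
        ⟨zero_mem _, ?_⟩ (fun x y ⟨hx, hx'⟩ ⟨hy, hy'⟩ => ⟨add_mem hx hy, ?_⟩) ht
      · obtain rfl : q' = q := by omega
        refine ⟨φ.wedge_mem_F _ ξ y, ?_⟩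
        rw [hσ]
        exact hg₀ ξ y
      · exact (congrArg g (map_zero σ)).trans ((map_zero g).trans (map_zero _).symm)
      · rw [map_add, ← hx', ← hy', ← map_add, ← map_add]
        rfl
    obtain ⟨ht', hgt⟩ := hg t.1 t.2
    have : σ ⟨t.1, ht'⟩ = 0 := ht
    rw [this, map_zero] at hgt
    exact (Submodule.Quotient.mk_eq_zero _).1 hgt.symm
  · obtain ⟨ht', h0⟩ : ∃ ht : t.1 ∈ φ.F E p n, σ ⟨t.1, ht⟩ = 0 := by
      refine φ.F_succ_induction (P := fun t => ∃ ht : t ∈ φ.F E p n, σ ⟨t, ht⟩ = 0)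
        (fun q' hq ξ y hy => ?_)
        ⟨zero_mem _, map_zero σ⟩ (fun x y ⟨hx, hx'⟩ ⟨hy, hy'⟩ => ⟨add_mem hx hy, ?_⟩) ht
      · obtain rfl : q' = q := by omega
        refine ⟨φ.wedge_mem_F _ ξ y, ?_⟩
        rw [hσ, φ.mMk_eq_zero.2 hy]
        exact BalTensor.tmul_zero ξ
      · exact (map_add σ ⟨x, hx⟩ ⟨y, hy⟩).trans (by rw [hx', hy', add_zero])
    exact h0

end DiffMap

/-! ### Exactness consequences of right flatness. -/

namespace RightFlat

open BalTensor

variable {k R M X Y : Type u} [Field k] [Ring R] [Algebra k R] [AddCommGroup M] [Module k M]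
    [Module Rᵐᵒᵖ M] [AddCommGroup X] [Module k X] [Module R X] [IsScalarTower k R X]
    [AddCommGroup Y] [Module k Y] [Module R Y] [IsScalarTower k R Y]

lemma mapRight_injective (hM : RightFlat k R M) {f : X →ₗ[R] Y} (hf : Function.Injective f) :
    Function.Injective (mapRight k M f) :=
  (hM X Y (Y ⧸ LinearMap.range f) (f.restrictScalars k)
    ((LinearMap.range f).mkQ.restrictScalars k) f.map_smul (LinearMap.range f).mkQ.map_smul hf
    (LinearMap.exact_map_mkQ_range f) (LinearMap.range f).mkQ_surjective).1

lemma exists_of_mapRight_mkQ_eq_zero (hM : RightFlat k R M) {p : Submodule R X}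
    {t : BalTensor k R M X} (ht : mapRight k M p.mkQ t = 0) :
    ∃ s, mapRight k M p.subtype s = t :=
  ((hM p X (X ⧸ p) (p.subtype.restrictScalars k) (p.mkQ.restrictScalars k) p.subtype.map_smul
    p.mkQ.map_smul p.subtype_injective (LinearMap.exact_subtype_mkQ p) p.mkQ_surjective).2.1 t).1 ht

/-- Flatness is stated for short exact sequences, so f is factored through its range: the inclusion
of the range stays injective after tensoring, and the kernel sequence stays exact. -/
lemma exists_of_mapRight_eq_zero (hM : RightFlat k R M) {f : X →ₗ[R] Y}
    {t : BalTensor k R M X} (ht : mapRight k M f t = 0) :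
    ∃ s, mapRight k M (LinearMap.ker f).subtype s = t := by
  have h0 : mapRight k M f.rangeRestrict t = 0 := by
    refine hM.mapRight_injective (LinearMap.range f).subtype_injective ?_
    rw [← mapRight_comp, map_zero]
    exact ht
  refine ((hM (LinearMap.ker f) X (LinearMap.range f)
    ((LinearMap.ker f).subtype.restrictScalars k) (f.rangeRestrict.restrictScalars k)
    (LinearMap.ker f).subtype.map_smul f.rangeRestrict.map_smul (LinearMap.ker f).subtype_injective
    ?_ f.surjective_rangeRestrict).2.1 t).1 h0
  intro x
  exact ⟨fun h => ⟨⟨x, congrArg Subtype.val h⟩, rfl⟩, fun ⟨y, hy⟩ => hy ▸ Subtype.ext y.2⟩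

end RightFlat

/-! ### The action of the differential on symbols. -/

namespace DiffMap

open DiffCalculus

variable {k A B : Type u} [Field k] [Ring A] [Algebra k A] [Ring B] [Algebra k B]
    {WB : DiffCalculus k B} {WA : DiffCalculus k A} {ι : B →ₐ[k] A} {φ : DiffMap WB WA ι}
    {E : Type u} [AddCommGroup E] [Module k E] [Module A E] {conn : WA.Connection E}

lemma ext_wedge_onΩ {p q n m p' q' : ℕ} (h : p + q = n) (hm : n + 1 = m) (hp : p + 1 = p')
    (hq : q + 1 = q') (h1 : p' + q = m) (h2 : p + q' = m) (ξ : WB.Ω p) (y : WA.Tw E q) :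
    conn.ext hm (WA.wedge h (φ.onΩ ξ) y) = WA.wedge h1 (φ.onΩ (WB.dΩ hp ξ)) y +
      (-1 : k) ^ p • WA.wedge h2 (φ.onΩ ξ) (conn.ext hq y) := by
  rw [conn.ext_wedge h hm hq hp h1 h2, φ.onΩ_dΩ]

/-- The symbol of `d(ι_*ξ ∧ y)` is `(-1)^p ξ ⊗ [∇y]`. -/
lemma IsSymbol.ext_wedge {p q n m q' : ℕ} (h : p + q = n) (hm : n + 1 = m) (hq : q + 1 = q')
    {h2 : p + q' = m} {σ : φ.F E p m →ₗ[k] WB.Tw (φ.M E q') p} (hσ : IsSymbol h2 σ)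
    (hσ0 : ∀ t : φ.F E p m, t.1 ∈ φ.F E (p + 1) m → σ t = 0) (ξ : WB.Ω p) (y : WA.Tw E q) :
    σ ⟨conn.ext hm (WA.wedge h (φ.onΩ ξ) y), φ.ext_mem_F conn hm (φ.wedge_mem_F h ξ y)⟩ =
      (-1 : k) ^ p • WB.tw ξ (φ.mMk (conn.ext hq y)) := by
  have h1 : p + 1 + q = m := by omega
  have hF := φ.wedge_mem_F h1 (WB.dΩ rfl ξ) y
  rw [← hσ, ← map_smul, ← sub_eq_zero, ← map_sub]
  refine hσ0 _ ?_
  change conn.ext hm (WA.wedge h (φ.onΩ ξ) y) -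
    (-1 : k) ^ p • WA.wedge h2 (φ.onΩ ξ) (conn.ext hq y) ∈ _
  rw [ext_wedge_onΩ h hm rfl hq h1 h2, add_sub_cancel_right]
  exact hF

/-- Identifies the differential of the associated graded complex as ± id ⊗ [∇]; the Leibniz term
ι_*(dξ) ∧ y has vanishing symbol. -/
lemma IsSymbol.ext {p q n m : ℕ} {h : p + q = n} (hm : n + 1 = m) {h2 : p + (q + 1) = m}
    {σ : φ.F E p n →ₗ[k] WB.Tw (φ.M E q) p} (hσ : IsSymbol h σ)
    {σ' : φ.F E p m →ₗ[k] WB.Tw (φ.M E (q + 1)) p} (hσ' : IsSymbol h2 σ')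
    (hσ0 : ∀ t : φ.F E p m, t.1 ∈ φ.F E (p + 1) m → σ' t = 0) (t : φ.F E p n) :
    σ' ⟨conn.ext hm t.1, φ.ext_mem_F conn hm t.2⟩ =
      (-1 : k) ^ p • BalTensor.mapRight k (WB.Ω p) (φ.dM conn q) (σ t) := by
  obtain ⟨ht, h0⟩ : ∃ ht : t.1 ∈ φ.F E p n,
      σ' ⟨conn.ext hm t.1, φ.ext_mem_F conn hm ht⟩ =
        (-1 : k) ^ p • BalTensor.mapRight k (WB.Ω p) (φ.dM conn q) (σ ⟨t.1, ht⟩) := by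
    refine φ.F_induction (P := fun t => ∃ ht : t ∈ φ.F E p n,
      σ' ⟨conn.ext hm t, φ.ext_mem_F conn hm ht⟩ =
        (-1 : k) ^ p • BalTensor.mapRight k (WB.Ω p) (φ.dM conn q) (σ ⟨t, ht⟩))
      (fun q' hq ξ y => ?_) ⟨zero_mem _, ?_⟩
      (fun x y ⟨hx, hx'⟩ ⟨hy, hy'⟩ => ⟨add_mem hx hy, ?_⟩) t.2
    · obtain rfl : q' = q := by omega
      refine ⟨φ.wedge_mem_F _ _ _, ?_⟩
      rw [hσ, hσ'.ext_wedge hq hm rfl hσ0, BalTensor.mapRight_tmul]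
      rfl
    · have e1 : (⟨conn.ext hm 0, φ.ext_mem_F conn hm (zero_mem _)⟩ : φ.F E p m) = 0 :=
        Subtype.ext (map_zero _)
      have e2 : (⟨0, zero_mem _⟩ : φ.F E p n) = 0 := rfl
      rw [e1, e2, map_zero, map_zero, map_zero, smul_zero]
    · have e1 : (⟨conn.ext hm (x + y), φ.ext_mem_F conn hm (add_mem hx hy)⟩ : φ.F E p m) =
          ⟨conn.ext hm x, φ.ext_mem_F conn hm hx⟩ + ⟨conn.ext hm y, φ.ext_mem_F conn hm hy⟩ :=
        Subtype.ext (map_add _ _ _)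
      have e2 : (⟨x + y, add_mem hx hy⟩ : φ.F E p n) = ⟨x, hx⟩ + ⟨y, hy⟩ := rfl
      rw [e1, e2, map_add, map_add, map_add, smul_add, hx', hy']
  exact h0

/-! ### The symbol relation -/

variable (φ conn) in
/-- `symbolRel` as a relation on `C^n`, `n = p + q`. -/
def symRel (p q n : ℕ) (h : p + q = n) :
    Submodule k (WA.Tw E n × WB.Tw (φ.Hhat conn q) p) :=
  Submodule.span k {t | ∃ (ξ : WB.Ω p) (y : WA.Tw E q)
    (hy : conn.ext (rfl : q + 1 = q + 1) y ∈ φ.F E 1 (q + 1)),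
    t = (WA.wedge h (φ.onΩ ξ) y, WB.tw ξ (φ.hatMk conn y hy))}

lemma wedge_mem_symRel {p q n : ℕ} (h : p + q = n) (ξ : WB.Ω p) {y : WA.Tw E q}
    (hy : conn.ext (rfl : q + 1 = q + 1) y ∈ φ.F E 1 (q + 1)) :
    (WA.wedge h (φ.onΩ ξ) y, WB.tw ξ (φ.hatMk conn y hy)) ∈ φ.symRel conn p q n h :=
  Submodule.subset_span ⟨ξ, y, hy, rfl⟩

lemma symRel_induction {p q n : ℕ} {h : p + q = n}
    {P : WA.Tw E n → WB.Tw (φ.Hhat conn q) p → Prop}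
    (wedge : ∀ (ξ : WB.Ω p) (y : WA.Tw E q)
      (hy : conn.ext (rfl : q + 1 = q + 1) y ∈ φ.F E 1 (q + 1)),
      P (WA.wedge h (φ.onΩ ξ) y) (WB.tw ξ (φ.hatMk conn y hy)))
    (zero : P 0 0) (add : ∀ x t x' t', P x t → P x' t' → P (x + x') (t + t'))
    {z : WA.Tw E n} {t : WB.Tw (φ.Hhat conn q) p} (hz : (z, t) ∈ φ.symRel conn p q n h) :
    P z t := by
  suffices H : ∀ x : WA.Tw E n × WB.Tw (φ.Hhat conn q) p, x ∈ φ.symRel conn p q n h →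
      ∀ c : k, P (c • x.1) (c • x.2) by simpa using H _ hz 1
  intro x hx
  induction hx using Submodule.span_induction with
  | mem x hx =>
    obtain ⟨ξ, y, hy, rfl⟩ := hx
    intro c
    have := wedge (c • ξ) y hy
    rwa [map_smul, map_smul, LinearMap.smul_apply, tw, BalTensor.smul_tmul] at this
  | zero => intro c; rwa [Prod.fst_zero, Prod.snd_zero, smul_zero, smul_zero]
  | add x y _ _ hx hy =>
    intro c
    rw [Prod.fst_add, Prod.snd_add, smul_add, smul_add]
    exact add _ _ _ _ (hx c) (hy c)
  | smul a x _ hx =>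
    intro c
    rw [Prod.smul_fst, Prod.smul_snd, smul_smul, smul_smul]
    exact hx _

lemma hatMk_eq_zero_of_mem_F {q : ℕ} {y : WA.Tw E q} (hy : y ∈ φ.F E 1 q)
    (hy' : conn.ext (rfl : q + 1 = q + 1) y ∈ φ.F E 1 (q + 1)) : φ.hatMk conn y hy' = 0 := by
  have : (⟨φ.mMk y, by rw [LinearMap.mem_ker, dM_mMk]; exact φ.mMk_eq_zero.2 hy'⟩ :
      LinearMap.ker (φ.dM conn q)) = 0 := Subtype.ext (φ.mMk_eq_zero.2 hy)
  rw [hatMk, this]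
  rfl

lemma hatMk_ext_eq_zero {q q' : ℕ} (hq : q + 1 = q') (y : WA.Tw E q)
    (hy : conn.ext rfl (conn.ext hq y) ∈ φ.F E 1 (q' + 1)) :
    φ.hatMk conn (conn.ext hq y) hy = 0 := by
  subst hq
  refine (Submodule.Quotient.mk_eq_zero _).2 ?_
  exact ⟨φ.mMk y, rfl⟩

lemma hatMk_surjective {q : ℕ} (x : φ.Hhat conn q) :
    ∃ (y : WA.Tw E q) (hy : conn.ext (rfl : q + 1 = q + 1) y ∈ φ.F E 1 (q + 1)),
      φ.hatMk conn y hy = x := by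
  obtain ⟨⟨m, hm⟩, rfl⟩ := Submodule.Quotient.mk_surjective _ x
  obtain ⟨y, rfl⟩ := φ.mMk_surjective m
  exact ⟨y, φ.mMk_eq_zero.1 hm, rfl⟩

lemma mem_symRel_of_mem_F {p q n : ℕ} (h : p + q = n) {z : WA.Tw E n}
    (hz : z ∈ φ.F E (p + 1) n) : (z, 0) ∈ φ.symRel conn p q n h := by
  refine φ.F_succ_induction (P := fun z => (z, 0) ∈ φ.symRel conn p q n h)
    (fun q' hq ξ y hy => ?_) (zero_mem _) (fun x y hx hy => ?_) hz
  · obtain rfl : q' = q := by omega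
    have h1 := wedge_mem_symRel (conn := conn) h ξ (φ.ext_mem_F_one conn rfl hy)
    rw [hatMk_eq_zero_of_mem_F hy] at h1
    have h2 : WB.tw ξ (0 : φ.Hhat conn q') = 0 := BalTensor.tmul_zero ξ
    rwa [h2] at h1
  · have := add_mem hx hy
    rwa [Prod.mk_add_mk, add_zero] at this

/-- Modulo F^{p+1}, d(ι_*ξ ∧ y) is ± ι_*ξ ∧ ∇y, and ⟨∇y⟩ = 0 in Ĥ_q. -/
lemma mem_symRel_of_mem_dF (hconn : conn.IsFlat) {p q n : ℕ} (h : p + q = n) {z : WA.Tw E n}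
    (hz : z ∈ φ.dF conn p n) : (z, 0) ∈ φ.symRel conn p q n h := by
  refine dF_induction (P := fun z => (z, 0) ∈ φ.symRel conn p q n h) (zero_mem _)
    (fun m hm w hw => ?_) hz
  refine φ.F_induction (P := fun w => (conn.ext hm w, 0) ∈ φ.symRel conn p q n h)
    (fun q' hq ξ y => ?_) (by rw [map_zero]; exact zero_mem _) (fun x y hx hy => ?_) hw
  · have hq' : q' + 1 = q := by omega
    have hy : conn.ext rfl (conn.ext hq' y) ∈ φ.F E 1 (q + 1) := by
      rw [hconn.ext_ext]
      exact zero_mem _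
    have h1 := wedge_mem_symRel h ξ hy
    rw [hatMk_ext_eq_zero hq' y hy] at h1
    have h2 : WB.tw ξ (0 : φ.Hhat conn q) = 0 := BalTensor.tmul_zero ξ
    rw [h2] at h1
    rw [ext_wedge_onΩ hq hm rfl hq' (by omega) h]
    have h3 := add_mem (mem_symRel_of_mem_F (conn := conn) h
      (φ.wedge_mem_F (show p + 1 + q' = n by omega) (WB.dΩ rfl ξ) y))
      (Submodule.smul_mem _ ((-1 : k) ^ p) h1)
    rwa [Prod.smul_mk, Prod.mk_add_mk, smul_zero, add_zero] at h3
  · have := add_mem hx hy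
    rwa [Prod.mk_add_mk, add_zero, ← map_add] at this

lemma symRel_fst_mem_F {p q n : ℕ} {h : p + q = n} {z : WA.Tw E n}
    {t : WB.Tw (φ.Hhat conn q) p} (hz : (z, t) ∈ φ.symRel conn p q n h) : z ∈ φ.F E p n :=
  symRel_induction (P := fun z _ => z ∈ φ.F E p n) (fun ξ y _ => φ.wedge_mem_F h ξ y)
    (zero_mem _) (fun _ _ _ _ hx hy => add_mem hx hy) hz

lemma symRel_ext_fst_mem_F {p q n m : ℕ} {h : p + q = n} (hm : n + 1 = m) {z : WA.Tw E n}
    {t : WB.Tw (φ.Hhat conn q) p} (hz : (z, t) ∈ φ.symRel conn p q n h) :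
    conn.ext hm z ∈ φ.F E (p + 1) m := by
  refine symRel_induction (P := fun z _ => conn.ext hm z ∈ φ.F E (p + 1) m) (fun ξ y hy => ?_)
    (by rw [map_zero]; exact zero_mem _)
    (fun _ _ _ _ hx hy => by rw [map_add]; exact add_mem hx hy) hz
  rw [ext_wedge_onΩ h hm rfl rfl (by omega) (by omega)]
  exact add_mem (φ.wedge_mem_F _ _ _) (Submodule.smul_mem _ _ (φ.wedge_F_mem rfl _ ξ hy))

lemma exists_symRel_snd {p q n : ℕ} (h : p + q = n) (t : WB.Tw (φ.Hhat conn q) p) :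
    ∃ z, (z, t) ∈ φ.symRel conn p q n h := by
  induction t using BalTensor.induction_on with
  | zero => exact ⟨0, zero_mem _⟩
  | tmul ξ x =>
    obtain ⟨y, hy, rfl⟩ := hatMk_surjective x
    exact ⟨_, wedge_mem_symRel h ξ hy⟩
  | add x y hx hy =>
    obtain ⟨z, hz⟩ := hx
    obtain ⟨z', hz'⟩ := hy
    exact ⟨z + z', add_mem hz hz'⟩

variable (φ conn) in
/-- The quotient map from the cycles in `M_{0,q}` to `Ĥ_q`. -/
def kerToHhat (q : ℕ) : LinearMap.ker (φ.dM conn q) →ₗ[B] φ.Hhat conn q :=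
  ((φ.imM conn q).submoduleOf (LinearMap.ker (φ.dM conn q))).mkQ

/-- Links the relation to the symbol in Ω^p B ⊗_B M_{0,q}: both come from one element of Ω^p B ⊗_B
ker [∇], to which flatness of Ω^p B can be applied. -/
lemma symRel_symbol {p q n : ℕ} {h : p + q = n} {σ : φ.F E p n →ₗ[k] WB.Tw (φ.M E q) p}
    (hσ : IsSymbol h σ) {z : WA.Tw E n} {t : WB.Tw (φ.Hhat conn q) p}
    (hz : (z, t) ∈ φ.symRel conn p q n h) :
    ∃ s : WB.Tw (LinearMap.ker (φ.dM conn q)) p,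
      BalTensor.mapRight k (WB.Ω p) (LinearMap.ker (φ.dM conn q)).subtype s =
        σ ⟨z, symRel_fst_mem_F hz⟩ ∧
      BalTensor.mapRight k (WB.Ω p) (φ.kerToHhat conn q) s = t := by
  obtain ⟨hz', s, hs⟩ : ∃ (hz : z ∈ φ.F E p n) (s : WB.Tw (LinearMap.ker (φ.dM conn q)) p),
      BalTensor.mapRight k (WB.Ω p) (LinearMap.ker (φ.dM conn q)).subtype s = σ ⟨z, hz⟩ ∧
      BalTensor.mapRight k (WB.Ω p) (φ.kerToHhat conn q) s = t := by
    refine symRel_induction (P := fun z t => ∃ (hz : z ∈ φ.F E p n)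
      (s : WB.Tw (LinearMap.ker (φ.dM conn q)) p),
      BalTensor.mapRight k (WB.Ω p) (LinearMap.ker (φ.dM conn q)).subtype s = σ ⟨z, hz⟩ ∧
      BalTensor.mapRight k (WB.Ω p) (φ.kerToHhat conn q) s = t) (fun ξ y hy => ?_)
      ⟨zero_mem _, 0, by rw [map_zero]; exact (map_zero σ).symm, map_zero _⟩
      (fun x t x' t' ⟨hx, s, hs, hst⟩ ⟨hx', s', hs', hst'⟩ => ⟨add_mem hx hx', s + s', ?_, ?_⟩) hz
    · refine ⟨φ.wedge_mem_F _ _ _, WB.tw ξ ⟨φ.mMk y, ?_⟩, ?_, ?_⟩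
      · rw [LinearMap.mem_ker, dM_mMk]
        exact φ.mMk_eq_zero.2 hy
      · rw [hσ, BalTensor.mapRight_tmul]
        rfl
      · rw [BalTensor.mapRight_tmul]
        rfl
    · rw [map_add, hs, hs', ← map_add]
      rfl
    · rw [map_add, hst, hst']
  exact ⟨s, hs⟩

/-- The symbol relation is functional. -/
lemma symRel_zero (hφ : φ.IsFibration) (hE : LeftFlat k A E)
    (hB : ∀ p, RightFlat k B (WB.Ω p)) {p q n : ℕ} {h : p + q = n}
    {t : WB.Tw (φ.Hhat conn q) p} (ht : ((0 : WA.Tw E n), t) ∈ φ.symRel conn p q n h) :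
    t = 0 := by
  obtain ⟨σ, hσ, -⟩ := exists_symbol hφ hE h
  obtain ⟨s, hs, rfl⟩ := symRel_symbol (σ := σ) hσ ht
  have h0 : (⟨0, symRel_fst_mem_F ht⟩ : φ.F E p n) = 0 := rfl
  have hs0 : s = 0 := (hB p).mapRight_injective (LinearMap.ker (φ.dM conn q)).subtype_injective
    (by rw [hs, h0, map_zero, map_zero])
  rw [hs0, map_zero]

/-- The symbol of an element of `F^p C^n` vanishes in `Ω^p B ⊗_B Ĥ_q` precisely on
`F^{p+1} C^n + d(F^p C^{n-1})`. -/
lemma symRel_eq_zero_iff (hφ : φ.IsFibration) (hE : LeftFlat k A E) (hconn : conn.IsFlat)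
    (hB : ∀ p, RightFlat k B (WB.Ω p)) {p q n : ℕ} {h : p + q = n} {z : WA.Tw E n}
    {t : WB.Tw (φ.Hhat conn q) p} (hz : (z, t) ∈ φ.symRel conn p q n h) :
    t = 0 ↔ ∃ u ∈ φ.F E (p + 1) n, ∃ w ∈ φ.dF conn p n, u + w = z := by
  constructor
  · intro ht
    obtain ⟨σ, hσ, hσ0⟩ := exists_symbol hφ hE h
    obtain ⟨s, hs, hst⟩ := symRel_symbol (σ := σ) hσ hz
    obtain ⟨s', rfl⟩ := (hB p).exists_of_mapRight_mkQ_eq_zero (hst.trans ht)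
    have key : ∀ s' : WB.Tw ((φ.imM conn q).submoduleOf (LinearMap.ker (φ.dM conn q))) p,
        ∃ (w : WA.Tw E n) (hw : w ∈ φ.dF conn p n), σ ⟨w, dF_le_F p n hw⟩ =
          BalTensor.mapRight k (WB.Ω p) (LinearMap.ker (φ.dM conn q)).subtype
            (BalTensor.mapRight k (WB.Ω p)
              ((φ.imM conn q).submoduleOf (LinearMap.ker (φ.dM conn q))).subtype s') := by
      intro s'
      induction s' using BalTensor.induction_on with
      | zero => exact ⟨0, zero_mem _, by rw [map_zero, map_zero]; exact map_zero σ⟩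
      | tmul ξ x =>
        rw [BalTensor.mapRight_tmul, BalTensor.mapRight_tmul]
        obtain ⟨⟨x, hx⟩, hx'⟩ := x
        change x ∈ φ.imM conn q at hx'
        change ∃ (w : WA.Tw E n) (hw : w ∈ φ.dF conn p n), σ ⟨w, dF_le_F p n hw⟩ = WB.tw ξ x
        cases q with
        | zero =>
          have hx0 : x = 0 := hx'
          subst hx0
          exact ⟨0, zero_mem _, (map_zero σ).trans (BalTensor.tmul_zero ξ).symm⟩
        | succ q =>
          obtain ⟨y, rfl⟩ := hx'
          obtain ⟨y, rfl⟩ := φ.mMk_surjective y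
          have hm : p + q + 1 = n := by omega
          -- The sign placed in ξ cancels the (-1)^p with which d acts on symbols.
          refine ⟨conn.ext hm (WA.wedge rfl (φ.onΩ ((-1 : k) ^ p • ξ)) y),
            ext_mem_dF hm (φ.wedge_mem_F _ _ _), ?_⟩
          rw [hσ.ext_wedge rfl hm rfl (fun t => (hσ0 t).2), tw, BalTensor.smul_tmul, smul_smul,
            ← mul_pow, neg_one_mul, neg_neg, one_pow, one_smul, dM_mMk]
      | add x y hx hy =>
        obtain ⟨w, hw, hwx⟩ := hx
        obtain ⟨w', hw', hwy⟩ := hy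
        refine ⟨w + w', add_mem hw hw', ?_⟩
        rw [map_add, map_add, ← hwx, ← hwy, ← map_add]
        rfl
    obtain ⟨w, hw, hws⟩ := key s'
    have h1 : σ (⟨z, symRel_fst_mem_F hz⟩ - ⟨w, dF_le_F p n hw⟩) = 0 := by
      rw [map_sub, hws, ← hs, sub_self]
    exact ⟨z - w, (hσ0 _).1 h1, w, hw, sub_add_cancel _ _⟩
  · rintro ⟨u, hu, w, hw, rfl⟩
    have h1 := sub_mem hz (add_mem (mem_symRel_of_mem_F (conn := conn) h hu)
      (mem_symRel_of_mem_dF hconn h hw))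
    rw [Prod.mk_add_mk, Prod.mk_sub_mk, sub_self, add_zero, sub_zero] at h1
    exact symRel_zero hφ hE hB h1

/-- As dz lies in F^{p+1}, the symbol of z is killed by id ⊗ [∇], hence by flatness comes from Ω^p B
⊗_B ker [∇]. An element w realising it is related to some t, and z - w in F^{p+1} is related to 0.
-/
lemma exists_symRel_fst (hφ : φ.IsFibration) (hE : LeftFlat k A E)
    (hB : ∀ p, RightFlat k B (WB.Ω p)) {p q n m : ℕ} (h : p + q = n) (hm : n + 1 = m)
    {z : WA.Tw E n} (hz : z ∈ φ.F E p n) (hz' : conn.ext hm z ∈ φ.F E (p + 1) m) :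
    ∃ t, (z, t) ∈ φ.symRel conn p q n h := by
  have h2 : p + (q + 1) = m := by omega
  obtain ⟨σ, hσ, hσ0⟩ := exists_symbol hφ hE h
  obtain ⟨σ', hσ', hσ'0⟩ := exists_symbol hφ hE h2
  have h3 := IsSymbol.ext (conn := conn) hm hσ hσ' (fun t => (hσ'0 t).2) ⟨z, hz⟩
  rw [(hσ'0 _).2 hz', eq_comm, smul_eq_zero_iff_right (pow_ne_zero _ (neg_ne_zero.2 one_ne_zero))]
    at h3
  obtain ⟨s, hs⟩ := (hB p).exists_of_mapRight_eq_zero h3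
  have key : ∀ s : WB.Tw (LinearMap.ker (φ.dM conn q)) p,
      ∃ (w : WA.Tw E n) (hw : w ∈ φ.F E p n) (t : WB.Tw (φ.Hhat conn q) p),
        (w, t) ∈ φ.symRel conn p q n h ∧ σ ⟨w, hw⟩ =
          BalTensor.mapRight k (WB.Ω p) (LinearMap.ker (φ.dM conn q)).subtype s := by
    intro s
    induction s using BalTensor.induction_on with
    | zero => exact ⟨0, zero_mem _, 0, zero_mem _, by rw [map_zero]; exact map_zero σ⟩
    | tmul ξ x =>
      obtain ⟨x, hx⟩ := x
      obtain ⟨y, rfl⟩ := φ.mMk_surjective x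
      have hy := φ.mMk_eq_zero.1 hx
      exact ⟨_, φ.wedge_mem_F h ξ y, _, wedge_mem_symRel h ξ hy, hσ ξ y⟩
    | add x y hx hy =>
      obtain ⟨w, hw, t, ht, hwx⟩ := hx
      obtain ⟨w', hw', t', ht', hwy⟩ := hy
      refine ⟨w + w', add_mem hw hw', t + t', add_mem ht ht', ?_⟩
      rw [map_add, ← hwx, ← hwy, ← map_add]
      rfl
  obtain ⟨w, hw, t, ht, hws⟩ := key s
  have h4 : σ (⟨z, hz⟩ - ⟨w, hw⟩) = 0 := by rw [map_sub, hws, hs, sub_self]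
  have h5 := add_mem (mem_symRel_of_mem_F (conn := conn) h ((hσ0 _).1 h4)) ht
  rw [Prod.mk_add_mk, zero_add] at h5
  refine ⟨t, ?_⟩
  convert h5 using 2
  exact (sub_add_cancel z w).symm

end DiffMap

/-- A functional linear relation that is total on `Z` is a linear map on `Z`. -/
lemma exists_linearMap_of_rel {k V W : Type*} [Ring k] [AddCommGroup V] [Module k V]
    [AddCommGroup W] [Module k W] (S : Submodule k (V × W)) (h0 : ∀ t, (0, t) ∈ S → t = 0)
    (Z : Submodule k V) (hZ : ∀ z ∈ Z, ∃ t, (z, t) ∈ S) :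
    ∃ τ : Z →ₗ[k] W, ∀ z : Z, (z.1, τ z) ∈ S := by
  have huniq : ∀ z t t', (z, t) ∈ S → (z, t') ∈ S → t = t' := fun z t t' h h' => by
    have := sub_mem h h'
    rw [Prod.mk_sub_mk, sub_self] at this
    exact sub_eq_zero.1 (h0 _ this)
  choose f hf using fun z : Z => hZ z.1 z.2
  exact ⟨{ toFun := f
           map_add' := fun x y => huniq _ _ _ (hf (x + y)) (add_mem (hf x) (hf y))
           map_smul' := fun c x => huniq _ _ _ (hf (c • x)) (S.smul_mem c (hf x)) }, hf⟩

namespace DiffMap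

open DiffCalculus

variable {k A B : Type u} [Field k] [Ring A] [Algebra k A] [Ring B] [Algebra k B]
    {WB : DiffCalculus k B} {WA : DiffCalculus k A} {ι : B →ₐ[k] A} {φ : DiffMap WB WA ι}
    {E : Type u} [AddCommGroup E] [Module k E] [Module A E] {conn : WA.Connection E}

/-! ### The induced covariant derivative -/

lemma symRel_unique (hφ : φ.IsFibration) (hE : LeftFlat k A E)
    (hB : ∀ p, RightFlat k B (WB.Ω p)) {p q n : ℕ} {h : p + q = n} {z : WA.Tw E n}
    {t t' : WB.Tw (φ.Hhat conn q) p} (ht : (z, t) ∈ φ.symRel conn p q n h)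
    (ht' : (z, t') ∈ φ.symRel conn p q n h) : t = t' := by
  have h1 := sub_mem ht ht'
  rw [Prod.mk_sub_mk, sub_self] at h1
  exact sub_eq_zero.1 (symRel_zero hφ hE hB h1)

lemma ext_mem_F_congr {p q m m' : ℕ} (hm : q + 1 = m) (hm' : q + 1 = m') {y : WA.Tw E q}
    (hy : conn.ext hm y ∈ φ.F E p m) : conn.ext hm' y ∈ φ.F E p m' := by
  subst hm
  subst hm'
  exact hy

lemma hatMk_eq_zero_imp {q : ℕ} {y : WA.Tw E q}
    {hy : conn.ext (rfl : q + 1 = q + 1) y ∈ φ.F E 1 (q + 1)} (h : φ.hatMk conn y hy = 0) :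
    ∃ u ∈ φ.F E 1 q, ∃ w ∈ φ.dF conn 0 q, u + w = y := by
  have h' : φ.mMk y ∈ φ.imM conn q := (Submodule.Quotient.mk_eq_zero
    ((φ.imM conn q).submoduleOf (LinearMap.ker (φ.dM conn q)))).1 h
  cases q with
  | zero => exact ⟨y, φ.mMk_eq_zero.1 h', 0, zero_mem _, add_zero _⟩
  | succ q =>
    obtain ⟨v, hv⟩ := h'
    obtain ⟨v, rfl⟩ := φ.mMk_surjective v
    refine ⟨y - conn.ext rfl v, φ.mMk_eq.1 hv.symm, conn.ext rfl v,
      ext_mem_dF rfl ?_, sub_add_cancel _ _⟩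
    rw [F_zero]
    trivial

lemma wedge_symRel {r p q s n m : ℕ} (hs : r + p = s) (hm : r + n = m) {h : p + q = n}
    {h' : s + q = m} (ξ : WB.Ω r) {z : WA.Tw E n} {t : WB.Tw (φ.Hhat conn q) p}
    (hz : (z, t) ∈ φ.symRel conn p q n h) :
    (WA.wedge hm (φ.onΩ ξ) z, WB.wedge hs ξ t) ∈ φ.symRel conn s q m h' := by
  refine symRel_induction (P := fun z t =>
    (WA.wedge hm (φ.onΩ ξ) z, WB.wedge hs ξ t) ∈ φ.symRel conn s q m h')
    (fun ζ y hy => ?_) (by rw [map_zero, map_zero]; exact zero_mem _)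
    (fun x t x' t' hx hx' => ?_) hz
  · have e : φ.onΩ (WB.mul hs ξ ζ) = WA.mul hs (φ.onΩ ξ) (φ.onΩ ζ) :=
      WA.val_injective (by simp)
    rw [WA.wedge_wedge h hm hs h', ← e, wedge_tw]
    exact wedge_mem_symRel h' _ hy
  · rw [map_add, map_add]
    exact add_mem hx hx'

/-- The submodule of elements of `C^q` representing classes in `Ĥ_q`. -/
def hatCycles (φ : DiffMap WB WA ι) (conn : WA.Connection E) (q : ℕ) :
    Submodule k (WA.Tw E q) :=
  (φ.F E 1 (q + 1)).comap (conn.ext rfl)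

/-- `hatMk` as a linear map. -/
def hatMkL (φ : DiffMap WB WA ι) (conn : WA.Connection E) (q : ℕ) :
    φ.hatCycles conn q →ₗ[k] φ.Hhat conn q where
  toFun y := φ.hatMk conn y.1 y.2
  map_add' _ _ := rfl
  map_smul' _ _ := rfl

lemma hatMkL_apply {q : ℕ} (y : φ.hatCycles conn q) :
    φ.hatMkL conn q y = φ.hatMk conn y.1 y.2 := rfl

lemma ext_act {q m : ℕ} (hm : q + 1 = m) (h1 : 1 + q = m) (b : B) (y : WA.Tw E q) :
    conn.ext hm (φ.act b y) = WA.wedge h1 (φ.onΩ (WB.dΩ rfl (WB.ofΩ b))) y +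
      WA.wedge (zero_add m) (φ.onΩ (WB.ofΩ b)) (conn.ext hm y) := by
  rw [act, ext_wedge_onΩ (zero_add q) hm (zero_add 1) hm h1 (zero_add m), pow_zero, one_smul]

lemma act_mem_hatCycles {q : ℕ} (b : B) {y : WA.Tw E q} (hy : y ∈ φ.hatCycles conn q) :
    φ.act b y ∈ φ.hatCycles conn q := by
  change conn.ext rfl (φ.act b y) ∈ φ.F E 1 (q + 1)
  rw [ext_act rfl (add_comm 1 q)]
  exact add_mem (φ.wedge_mem_F _ _ _) (φ.wedge_F_mem (zero_add 1) _ _ hy)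

lemma exists_symRel_ext (hφ : φ.IsFibration) (hE : LeftFlat k A E)
    (hconn : conn.IsFlat) (hB : ∀ p, RightFlat k B (WB.Ω p)) {q : ℕ} {y : WA.Tw E q}
    (hy : y ∈ φ.hatCycles conn q) :
    ∃ t, (conn.ext (add_comm q 1) y, t) ∈ φ.symRel conn 1 q (1 + q) rfl := by
  refine exists_symRel_fst hφ hE hB (m := 1 + q + 1) rfl rfl (ext_mem_F_congr rfl _ hy) ?_
  rw [hconn.ext_ext]
  exact zero_mem _

lemma exists_symbol_hatCycles (hφ : φ.IsFibration) (hE : LeftFlat k A E)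
    (hconn : conn.IsFlat) (hB : ∀ p, RightFlat k B (WB.Ω p)) (q : ℕ) :
    ∃ τ : φ.hatCycles conn q →ₗ[k] WB.Tw (φ.Hhat conn q) 1, ∀ y : φ.hatCycles conn q,
      (conn.ext (add_comm q 1) y.1, τ y) ∈ φ.symRel conn 1 q (1 + q) rfl :=
  -- Pulling the relation back along d in its first entry makes it a relation between y and the
  -- symbol of ∇y.
  exists_linearMap_of_rel ((φ.symRel conn 1 q (1 + q) rfl).comap
    (LinearMap.prodMap (conn.ext (add_comm q 1)) LinearMap.id))
    (fun t ht => by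
      have h1 : (conn.ext (add_comm q 1) 0, t) ∈ φ.symRel conn 1 q (1 + q) rfl := ht
      rw [map_zero] at h1
      exact symRel_zero hφ hE hB h1)
    (φ.hatCycles conn q) (fun _ hy => exists_symRel_ext hφ hE hconn hB hy)

lemma exists_induced_linearMap (hφ : φ.IsFibration) (hE : LeftFlat k A E)
    (hconn : conn.IsFlat) (hB : ∀ p, RightFlat k B (WB.Ω p)) (q : ℕ) :
    ∃ g : φ.Hhat conn q →ₗ[k] WB.Tw (φ.Hhat conn q) 1, ∀ (y : WA.Tw E q)
      (hy : y ∈ φ.hatCycles conn q), (conn.ext (add_comm q 1) y, g (φ.hatMk conn y hy)) ∈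
        φ.symRel conn 1 q (1 + q) rfl := by
  obtain ⟨τ, hτ⟩ := exists_symbol_hatCycles (φ := φ) hφ hE hconn hB q
  obtain ⟨g, hg⟩ := exists_linearMap_of_surjective (φ.hatMkL conn q) τ
    (fun x => by
      obtain ⟨y, hy, rfl⟩ := hatMk_surjective x
      exact ⟨⟨y, hy⟩, rfl⟩)
    (fun y hy => by
      rw [hatMkL_apply] at hy
      -- A representative of the zero class is u + w with u in F^1 and w a coboundary, so ∇y = du,
      -- which is related to 0.
      obtain ⟨u, hu, w, hw, huw⟩ := hatMk_eq_zero_imp hy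
      have h1 := hτ y
      rw [← huw, map_add, ext_dF hconn _ hw, add_zero] at h1
      exact symRel_unique hφ hE hB h1 (mem_symRel_of_mem_dF hconn rfl (ext_mem_dF _ hu)))
  refine ⟨g, fun y hy => ?_⟩
  have e : g (φ.hatMk conn y hy) = τ ⟨y, hy⟩ := hg ⟨y, hy⟩
  rw [e]
  exact hτ ⟨y, hy⟩

lemma smul_hatMk {q : ℕ} (b : B) {y : WA.Tw E q} (hy : y ∈ φ.hatCycles conn q) :
    b • φ.hatMk conn y hy = φ.hatMk conn (φ.act b y) (act_mem_hatCycles b hy) := rfl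

lemma exists_induced_connection (hφ : φ.IsFibration) (hE : LeftFlat k A E)
    (hconn : conn.IsFlat) (hB : ∀ p, RightFlat k B (WB.Ω p)) (q : ℕ) :
    ∃ nq : WB.Connection (φ.Hhat conn q), φ.IsInduced conn q nq := by
  obtain ⟨g, hg⟩ := exists_induced_linearMap (φ := φ) hφ hE hconn hB q
  refine ⟨⟨g, fun b x => ?_⟩, hg⟩
  obtain ⟨y, hy, rfl⟩ := hatMk_surjective x
  have h1 := hg _ (act_mem_hatCycles b hy)
  rw [ext_act (add_comm q 1) rfl] at h1
  rw [smul_hatMk b hy]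
  exact symRel_unique hφ hE hB h1 (add_mem (wedge_mem_symRel rfl _ hy)
    (wedge_symRel (zero_add 1) (zero_add (1 + q)) (WB.ofΩ b) (hg y hy)))

/-- On a generator both entries expand by the same Leibniz rule, and ∇y is related to ∇_q⟨y⟩ because
∇_q is induced. -/
lemma IsInduced.ext_mem_symRel {q : ℕ} {nq : WB.Connection (φ.Hhat conn q)}
    (hnq : φ.IsInduced conn q nq) {p p' n m : ℕ} (hp : p + 1 = p') (hm : n + 1 = m)
    {h : p + q = n} {h' : p' + q = m} {z : WA.Tw E n} {t : WB.Tw (φ.Hhat conn q) p}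
    (hz : (z, t) ∈ φ.symRel conn p q n h) :
    (conn.ext hm z, nq.ext hp t) ∈ φ.symRel conn p' q m h' := by
  refine symRel_induction (P := fun z t =>
    (conn.ext hm z, nq.ext hp t) ∈ φ.symRel conn p' q m h')
    (fun ξ y hy => ?_) (by rw [map_zero, map_zero]; exact zero_mem _)
    (fun x t x' t' hx hx' => ?_) hz
  · rw [ext_wedge_onΩ h hm hp (add_comm q 1) h' (by omega), Connection.ext_tw]
    exact add_mem (wedge_mem_symRel h' _ hy)
      (Submodule.smul_mem _ ((-1 : k) ^ p) (wedge_symRel hp _ ξ (hnq y hy)))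
  · rw [map_add, map_add]
    exact add_mem hx hx'

lemma IsInduced.isFlat (hφ : φ.IsFibration) (hE : LeftFlat k A E) (hconn : conn.IsFlat)
    (hB : ∀ p, RightFlat k B (WB.Ω p)) {q : ℕ} {nq : WB.Connection (φ.Hhat conn q)}
    (hnq : φ.IsInduced conn q nq) : nq.IsFlat := by
  intro x
  obtain ⟨y, hy, rfl⟩ := hatMk_surjective x
  have h1 := hnq.ext_mem_symRel (show 1 + 1 = 2 from rfl) (rfl : 1 + q + 1 = 1 + q + 1)
    (h' := by omega) (hnq y hy)
  rw [hconn.ext_ext] at h1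
  exact symRel_zero hφ hE hB h1

/-! ### The second page -/

/-- The symbols `ξ ⊗ ⟨y⟩` of elements of `Z_2^{p,q}`. -/
lemma exists_symbol_Z_two (hφ : φ.IsFibration) (hE : LeftFlat k A E)
    (hB : ∀ p, RightFlat k B (WB.Ω p)) {q : ℕ} {nq : WB.Connection (φ.Hhat conn q)}
    (hnq : φ.IsInduced conn q nq) (p : ℕ) :
    ∃ τ : φ.Z conn 2 p (p + q) →ₗ[k] nq.cocycles p,
      ∀ z, (z.1, (τ z).1) ∈ φ.symRel conn p q (p + q) rfl := by
  obtain ⟨τ, hτ⟩ := exists_linearMap_of_rel (φ.symRel conn p q (p + q) rfl)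
    (fun t => symRel_zero hφ hE hB) (φ.Z conn 2 p (p + q)) (fun z hz =>
      exists_symRel_fst hφ hE hB rfl rfl ((mem_Z rfl).1 hz).1
        (φ.F_succ_le _ _ ((mem_Z rfl).1 hz).2))
  refine ⟨τ.codRestrict (nq.cocycles p) fun z => (mem_cocycles rfl).2 ?_, hτ⟩
  have h' : p + 1 + q = p + q + 1 := by omega
  have h1 := hnq.ext_mem_symRel rfl rfl (h' := h') (hτ z)
  exact symRel_unique hφ hE hB h1 (mem_symRel_of_mem_F h' ((mem_Z rfl).1 z.2).2)

lemma symRel_coboundary_imp {q : ℕ} {nq : WB.Connection (φ.Hhat conn q)}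
    (hnq : φ.IsInduced conn q nq) {p n : ℕ} {h : p + q = n} {t : WB.Tw (φ.Hhat conn q) p}
    (ht : t ∈ nq.coboundaries p) :
    ∃ b ∈ φ.F E p n, b ∈ φ.dF conn (p - 1) n ∧ (b, t) ∈ φ.symRel conn p q n h := by
  cases p with
  | zero =>
    have ht0 : t = 0 := ht
    subst ht0
    exact ⟨0, zero_mem _, zero_mem _, zero_mem _⟩
  | succ p =>
    obtain ⟨s, rfl⟩ := ht
    obtain ⟨v, hv⟩ := exists_symRel_snd (φ := φ) (conn := conn) (rfl : p + q = p + q) s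
    have hm : p + q + 1 = n := by omega
    exact ⟨conn.ext hm v, symRel_ext_fst_mem_F hm hv, ext_mem_dF hm (symRel_fst_mem_F hv),
      hnq.ext_mem_symRel rfl hm hv⟩

lemma symRel_coboundary_of_mem (hφ : φ.IsFibration) (hE : LeftFlat k A E)
    (hconn : conn.IsFlat) (hB : ∀ p, RightFlat k B (WB.Ω p)) {q : ℕ}
    {nq : WB.Connection (φ.Hhat conn q)} (hnq : φ.IsInduced conn q nq) {p n : ℕ}
    {h : p + q = n} {b : WA.Tw E n} (hb : b ∈ φ.F E p n) (hb' : b ∈ φ.dF conn (p - 1) n) :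
    ∃ t ∈ nq.coboundaries p, (b, t) ∈ φ.symRel conn p q n h := by
  cases p with
  -- For p = 0 the index p - 1 truncates to 0, so b is a coboundary from F^0 and its symbol already
  -- vanishes in Ĥ_q.
  | zero => exact ⟨0, zero_mem _, mem_symRel_of_mem_dF hconn h hb'⟩
  | succ p =>
    have hm : p + q + 1 = n := by omega
    obtain ⟨w, hw, rfl⟩ := exists_of_mem_dF hm hb'
    obtain ⟨s, hs⟩ := exists_symRel_fst hφ hE hB (rfl : p + q = p + q) hm hw hb
    exact ⟨nq.ext rfl s, ⟨s, rfl⟩, hnq.ext_mem_symRel rfl hm hs⟩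

/-- For any z with symbol t, the symbol ∇_q^{[p]} t of dz is zero, so dz = u + dv with u in F^{p+2}
and v in F^{p+1}. Then z - v lies in Z_2 and has the same symbol. -/
lemma exists_Z_two_symRel (hφ : φ.IsFibration) (hE : LeftFlat k A E) (hconn : conn.IsFlat)
    (hB : ∀ p, RightFlat k B (WB.Ω p)) {q : ℕ} {nq : WB.Connection (φ.Hhat conn q)}
    (hnq : φ.IsInduced conn q nq) {p n : ℕ} (h : p + q = n) {t : WB.Tw (φ.Hhat conn q) p}
    (ht : t ∈ nq.cocycles p) :
    ∃ z ∈ φ.Z conn 2 p n, (z, t) ∈ φ.symRel conn p q n h := by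
  obtain ⟨z, hz⟩ := exists_symRel_snd (φ := φ) (conn := conn) h t
  have h' : p + 1 + q = n + 1 := by omega
  obtain ⟨u, hu, w, hw, huw⟩ := (symRel_eq_zero_iff hφ hE hconn hB
    (hnq.ext_mem_symRel rfl rfl (h' := h') hz)).1 ((mem_cocycles rfl).1 ht)
  obtain ⟨v, hv, rfl⟩ := exists_of_mem_dF rfl hw
  refine ⟨z - v, (mem_Z rfl).2 ⟨sub_mem (symRel_fst_mem_F hz) (φ.F_succ_le _ _ hv), ?_⟩, ?_⟩
  · rw [map_sub, ← huw, add_sub_cancel_right]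
    exact hu
  · have h1 := sub_mem hz (mem_symRel_of_mem_F (conn := conn) h hv)
    rwa [Prod.mk_sub_mk, sub_zero] at h1

lemma mem_coboundaries_iff_of_symRel (hφ : φ.IsFibration) (hE : LeftFlat k A E)
    (hconn : conn.IsFlat) (hB : ∀ p, RightFlat k B (WB.Ω p)) {q : ℕ}
    {nq : WB.Connection (φ.Hhat conn q)} (hnq : φ.IsInduced conn q nq) {p n : ℕ}
    {h : p + q = n} {z : φ.Z conn 2 p n} {t : WB.Tw (φ.Hhat conn q) p}
    (hzt : (z.1, t) ∈ φ.symRel conn p q n h) :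
    φ.toPage conn 2 p n z = 0 ↔ t ∈ nq.coboundaries p := by
  rw [toPage_eq_zero]
  constructor
  · rintro ⟨u, hu, b, hb, hub⟩
    obtain ⟨t', ht', hbt⟩ := symRel_coboundary_of_mem hφ hE hconn hB hnq (h := h)
      (mem_Bd.1 hb).1 (mem_Bd.1 hb).2
    have h1 := add_mem (mem_symRel_of_mem_F (conn := conn) h ((mem_Z rfl).1 hu).1) hbt
    rw [Prod.mk_add_mk, zero_add, hub] at h1
    rwa [symRel_unique hφ hE hB hzt h1]
  · intro ht
    obtain ⟨b, hb, hb', hbt⟩ := symRel_coboundary_imp hnq (h := h) ht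
    have h1 := sub_mem hzt hbt
    rw [Prod.mk_sub_mk, sub_self] at h1
    obtain ⟨u, hu, w, hw, huw⟩ := (symRel_eq_zero_iff hφ hE hconn hB h1).1 rfl
    have hz : z.1 = u + (w + b) := by rw [← add_assoc, huw, sub_add_cancel]
    have hw' : w ∈ φ.dF conn (p - 1) n := dF_antitone _ (Nat.sub_le p 1) hw
    -- A priori u lies only in F^{p+1}, that is, in Z_0^{p+1}; since du = dz lies in F^{p+2}, it
    -- belongs to Z_1^{p+1}.
    refine ⟨u, mem_Z_of_ext_eq (r := 1) ?_ z.2 ?_, w + b,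
      mem_Bd.2 ⟨add_mem (dF_le_F _ _ hw) hb, add_mem hw' hb'⟩, hz.symm⟩
    · exact (mem_Z rfl).2 ⟨hu, φ.ext_mem_F conn rfl hu⟩
    · rw [hz, map_add, map_add, ext_dF hconn rfl hw', ext_dF hconn rfl hb', add_zero,
        add_zero]

lemma secondPageIso (hφ : φ.IsFibration) (hE : LeftFlat k A E) (hconn : conn.IsFlat)
    (hB : ∀ p, RightFlat k B (WB.Ω p)) {nq : ∀ q, WB.Connection (φ.Hhat conn q)}
    (hnq : ∀ q, φ.IsInduced conn q (nq q)) :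
    φ.SecondPageIso conn (φ.filtrationIdent hconn) nq := by
  intro p q
  obtain ⟨τ, hτ⟩ := exists_symbol_Z_two hφ hE hB (hnq q) p
  have hτu : ∀ z t, (z.1, t.1) ∈ φ.symRel conn p q (p + q) rfl → τ z = t := fun z t hzt =>
    Subtype.ext (symRel_unique hφ hE hB (hτ z) hzt)
  have hsurj : Function.Surjective τ := fun t => by
    obtain ⟨z, hz, hzt⟩ := exists_Z_two_symRel hφ hE hconn hB (hnq q) rfl t.2
    exact ⟨⟨z, hz⟩, hτu ⟨z, hz⟩ t hzt⟩
  obtain ⟨e, he⟩ := exists_linearEquiv_of_ker_eq (φ.toPage conn 2 p (p + q))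
    ((nq q).cohMk.comp τ) (toPage_surjective _ _ _)
    ((cohMk_surjective (conn := nq q) p).comp hsurj) (fun z => by
      rw [mem_coboundaries_iff_of_symRel hφ hE hconn hB (hnq q) (hτ z), LinearMap.comp_apply,
        cohMk_eq_zero])
  exact ⟨e, fun z t hzt => (he z).trans (congrArg (nq q).cohMk (hτu z t hzt))⟩

end DiffMap

open CategoryTheory in
theorem mainTheorem1 {k A B E : Type u} [Field k] [Ring A] [Algebra k A] [Ring B] [Algebra k B]
    [AddCommGroup E] [Module k E] [Module A E] [IsScalarTower k A E]
    (WA : DiffCalculus k A) (WB : DiffCalculus k B) (ι : B →ₐ[k] A) (φ : DiffMap WB WA ι)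
    (hφ : φ.IsFibration)
    (hE : LeftFlat k A E)
    (conn : WA.Connection E) (hconn : conn.IsFlat)
    (hB : ∀ p, RightFlat k B (WB.Ω p)) :
    ∃ nq : ∀ q, WB.Connection (φ.Hhat conn q),
      (∀ q, φ.IsInduced conn q (nq q) ∧ (nq q).IsFlat) ∧
      ∃ (ss : CohomologicalSpectralSequenceNat (ModuleCat.{u} k) 1)
        (I : φ.FiltrationIdent conn ss),
        φ.SecondPageIso conn I nq ∧ φ.ConvergesToCoh conn I := by
  choose nq hnq using DiffMap.exists_induced_connection hφ hE hconn hB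
  exact ⟨nq, fun q => ⟨hnq q, (hnq q).isFlat hφ hE hconn hB⟩, φ.filtrationSS hconn,
    φ.filtrationIdent hconn, DiffMap.secondPageIso hφ hE hconn hB hnq,
    DiffMap.convergesToCoh hconn⟩
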